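/- **Theorem (transient case, critical value $\sigma_{cr}$).** Let $d\ge 1$ and $0<\alpha\le 2$. Let $a:\mathbb Z^d\to[0,\infty)$ satisfy $a(-z)=a(z)$, $\sum_{z}a(z)=1$, $a(0)=0$, and $a(z)>0$ whenever $|z|=1$, and let $$(\mathcal L\psi)(x)=\sum_{z\ne 0}a(z)\,(\psi(x+z)-\psi(x)),\qquad \hat a(k)=\sum_{z\in\mathbb Z^d}a(z)\cos(k,z).$$ Assume that $$\hat a(k)=\exp\bigl(-\beta(k/|k|)\,|k|^{\alpha}(1+o(1))\bigr),\qquad k\to 0,$$ where $\beta$ is a continuous, positive and symmetric ($\beta(-\theta)=\beta(\theta)$) function on the unit sphere of $\mathbb R^d$. Let $V:\mathbb Z^d\to\mathbb R$ satisfy one of the following conditions: - ($d=1$ and $\alpha<1$, or $d=2$ and $\alpha<2$) and $\sum_{x}|V(x)|^{d/\alpha}<\infty$; - $d\ge 3$ and $\sum_{x}|V(x)|^{d/2}<\infty$; and let $V(x_0)>0$ for at least one point $x_0$. For $\sigma>0$ consider the operator $H\psi=\mathcal L\psi+\sigma V\psi$ in $\ell^2(\mathbb Z^d)$. Then there exists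 a critical value $\sigma_{cr}\in(0,\infty)$ such that $H$ has no positive eigenvalues when $0<\sigma<\sigma_{cr}$, and $H$ has a positive eigenvalue when $\sigma>\sigma_{cr}$. -/

import Mathlib

open Filter Topology

/-- A jump distribution of a non-degenerate symmetric random walk on `ℤ^d`: `a ≥ 0`,
`a(-z) = a(z)`, `∑ a(z) = 1`, `a(0) = 0`, and `a(z) > 0` for all `z` of Euclidean length `1`. -/
structure IsJumpDistribution {d : ℕ} (a : (Fin d → ℤ) → ℝ) : Prop where
  nonneg : ∀ z, 0 ≤ a z
  symm : ∀ z, a (-z) = a z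
  hasSum_one : HasSum a 1
  zero : a 0 = 0
  pos_of_unit : ∀ z : Fin d → ℤ, ∑ i, z i ^ 2 = 1 → 0 < a z

/-- The Fourier transform `â(k) = ∑_z a(z) cos (k, z)` of a symmetric jump distribution. -/
noncomputable def jumpSymbol {d : ℕ} (a : (Fin d → ℤ) → ℝ) (k : EuclideanSpace ℝ (Fin d)) : ℝ :=
  ∑' z : Fin d → ℤ, a z * Real.cos (∑ i, k i * (z i : ℝ))

/-- `â(k) = exp (-β(k/|k|) |k|^α (1 + o(1)))` as `k → 0`, with `β` a continuous, symmetric and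
positive function on the unit sphere (the values of `β` off the sphere play no role). -/
def HasSymbolAsymptotics {d : ℕ} (a : (Fin d → ℤ) → ℝ) (α : ℝ) : Prop :=
  ∃ β r : EuclideanSpace ℝ (Fin d) → ℝ,
    ContinuousOn β (Metric.sphere 0 1) ∧
    (∀ θ ∈ Metric.sphere (0 : EuclideanSpace ℝ (Fin d)) 1, 0 < β θ ∧ β (-θ) = β θ) ∧
    Tendsto r (𝓝[≠] 0) (𝓝 0) ∧
    ∀ᶠ k in 𝓝[≠] (0 : EuclideanSpace ℝ (Fin d)),
      jumpSymbol a k = Real.exp (-(β (‖k‖⁻¹ • k) * ‖k‖ ^ α * (1 + r k)))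

/-- The Cwikel–Lieb–Rozenblum type condition on the potential, including the restrictions on
`d` and `α` under which the random walk is transient. -/
def CLRCondition {d : ℕ} (α : ℝ) (V : (Fin d → ℤ) → ℝ) : Prop :=
  (((d = 1 ∧ α < 1) ∨ (d = 2 ∧ α < 2)) ∧ Summable fun x => |V x| ^ ((d : ℝ) / α)) ∨
  (3 ≤ d ∧ Summable fun x => |V x| ^ ((d : ℝ) / 2))

/-- The non-local Laplacian `(Lψ)(x) = ∑_z a(z) (ψ(x + z) - ψ(x))`
(the term with `z = 0` vanishes). -/
noncomputable def nonlocalLaplacian {d : ℕ} (a : (Fin d → ℤ) → ℝ) (ψ : (Fin d → ℤ) → ℂ) :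
    (Fin d → ℤ) → ℂ :=
  fun x => ∑' z : Fin d → ℤ, (a z : ℂ) * (ψ (x + z) - ψ x)

/-- The Schrödinger operator `H = L + σV`. -/
noncomputable def schrodingerOp {d : ℕ} (a : (Fin d → ℤ) → ℝ) (V : (Fin d → ℤ) → ℝ) (σ : ℝ)
    (ψ : (Fin d → ℤ) → ℂ) : (Fin d → ℤ) → ℂ :=
  fun x => nonlocalLaplacian a ψ x + (σ : ℂ) * (V x : ℂ) * ψ x

/-- `lam` is an eigenvalue of `H = L + σV` in `ℓ²(ℤ^d)`. -/
def IsSchrodingerEigenvalue {d : ℕ} (a : (Fin d → ℤ) → ℝ) (V : (Fin d → ℤ) → ℝ) (σ lam : ℝ) :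
    Prop :=
  ∃ ψ : lp (fun _ : Fin d → ℤ => ℂ) 2, ψ ≠ 0 ∧
    ∀ x, schrodingerOp a V σ (ψ : (Fin d → ℤ) → ℂ) x = (lam : ℂ) * ψ x

/-! Let `D = 1 - ∑ a(z) S_z` with `S_z` the translations, so that `H = σV - D` and `D ≥ 0`. As `V`
vanishes at infinity, multiplication by `σV` is compact. Subtracting `D ≥ 0` leaves no essential
spectrum above zero, so a positive value of the form of `H` forces a positive eigenvalue
(`exists_pos_eigenvalue_of_compact_sub_nonneg`); the converse is immediate. Hence a positive
eigenvalue exists iff `⟨Dψ, ψ⟩ < σ⟨Vψ, ψ⟩` for some `ψ`. This condition persists as `σ > 0` grows,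
and a delta function at a point with `V > 0` satisfies it for large `σ`. The critical value is the
infimum of such `σ`; what needs work is that it is not zero.

That follows from the form bound `∑ |V||ψ|² ≤ K⟨Dψ, ψ⟩` (`exists_tsum_abs_mul_norm_sq_le`). On the
Fourier side `2⟨Dψ, ψ⟩ = ∫ s|f|²` with `s = 2(1 - â)`. A bound `1 - â ≥ c|k|^γ`, with `γ = α` or `γ
= 2`, gives `|{s ≤ r}| ≤ C r^p` for `p = d/γ`, and transience enters as `p > 1`. With `W` a
rescaling of `|V|`, a dyadic argument in the style of Cwikel
(`exists_tsum_mul_enorm_integral_sq_le`) cuts `f` at `s = 2⁻ⁿ` for those `x` with `W(x) ≈ 2⁻ⁿ`.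
Cauchy–Schwarz on the low part costs a factor `W(x)^p`, which is summable; Bessel's inequality
handles the high parts, whose weighted sum over `n` is at most `2 ∫ s|f|²`. -/

/-! ### Positive eigenvalues of a compact operator minus a nonnegative one -/

section Spectral

variable {E : Type*} [NormedAddCommGroup E] [InnerProductSpace ℂ E]

/-- Cauchy–Schwarz type bound `‖Bψ‖² ≤ (‖B‖ + 1) ⟨Bψ, ψ⟩` for a nonnegative symmetric `B`. -/
lemma norm_apply_sq_le_of_nonneg (B : E →L[ℂ] E)
    (hsymm : ∀ x y, inner ℂ (B x) y = inner ℂ x (B y))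
    (hnonneg : ∀ x, 0 ≤ (inner ℂ (B x) x).re) (x : E) :
    ‖B x‖ ^ 2 ≤ (‖B‖ + 1) * (inner ℂ (B x) x).re := by
  set b := ‖B‖ + 1 with hb
  have hb0 : 0 < b := by positivity
  -- Testing nonnegativity at `x - b⁻¹Bx` replaces Cauchy–Schwarz for the form of `B`; the `+ 1` in
  -- `b` keeps it invertible when `B = 0`.
  have h := hnonneg (x - ((b⁻¹ : ℝ) : ℂ) • B x)
  have h1 : (inner ℂ (B x) (B x)).re = ‖B x‖ ^ 2 := by
    rw [← inner_self_eq_norm_sq (𝕜 := ℂ)]; rfl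
  have h2 : (inner ℂ (B (B x)) (B x)).re ≤ b * ‖B x‖ ^ 2 := by
    calc (inner ℂ (B (B x)) (B x)).re ≤ ‖B (B x)‖ * ‖B x‖ := re_inner_le_norm (𝕜 := ℂ) _ _
      _ ≤ (‖B‖ * ‖B x‖) * ‖B x‖ := by gcongr; exact B.le_opNorm _
      _ ≤ b * ‖B x‖ ^ 2 := by nlinarith [sq_nonneg ‖B x‖]
  have h3 : (inner ℂ (B (x - ((b⁻¹ : ℝ) : ℂ) • B x)) (x - ((b⁻¹ : ℝ) : ℂ) • B x)).re =
      (inner ℂ (B x) x).re - 2 * b⁻¹ * ‖B x‖ ^ 2 + b⁻¹ ^ 2 * (inner ℂ (B (B x)) (B x)).re := by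
    simp only [map_sub, map_smul, inner_sub_left, inner_sub_right, inner_smul_left,
      inner_smul_right, Complex.conj_ofReal, Complex.sub_re, Complex.re_ofReal_mul, hsymm (B x) x,
      h1]
    ring
  rw [h3] at h
  have h4 : b⁻¹ ^ 2 * (inner ℂ (B (B x)) (B x)).re ≤ b⁻¹ ^ 2 * (b * ‖B x‖ ^ 2) := by gcongr
  have h5 : b⁻¹ ^ 2 * (b * ‖B x‖ ^ 2) = b⁻¹ * ‖B x‖ ^ 2 := by field_simp
  have h6 : b⁻¹ * ‖B x‖ ^ 2 ≤ (inner ℂ (B x) x).re := by linarith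
  rwa [inv_mul_le_iff₀ hb0] at h6

/-- If `D ≥ 0` and `K` is compact, and the quadratic form of `K - D` takes a positive value, then
`K - D` has a positive eigenvalue. -/
theorem exists_pos_eigenvalue_of_compact_sub_nonneg [CompleteSpace E] (D K : E →L[ℂ] E)
    (hD : ∀ x y, inner ℂ (D x) y = inner ℂ x (D y))
    (hK : ∀ x y, inner ℂ (K x) y = inner ℂ x (K y))
    (hD0 : ∀ x, 0 ≤ (inner ℂ (D x) x).re) (hKc : IsCompactOperator K)
    (hpos : ∃ x, 0 < (inner ℂ (K x - D x) x).re) :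
    ∃ lam : ℝ, 0 < lam ∧ ∃ x : E, x ≠ 0 ∧ K x - D x = (lam : ℂ) • x := by
  set H : E →L[ℂ] E := K - D with hH
  let S : Set ℝ := (fun x => (inner ℂ (H x) x).re) '' Metric.sphere 0 1
  have hscale : ∀ (c : ℝ) (x : E), (inner ℂ (H ((c : ℂ) • x)) ((c : ℂ) • x)).re =
      c ^ 2 * (inner ℂ (H x) x).re := by
    intro c x
    simp only [map_smul, inner_smul_left, inner_smul_right, Complex.conj_ofReal,
      Complex.re_ofReal_mul]
    ring
  obtain ⟨x₀, hx₀⟩ := hpos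
  have hx₀' : x₀ ≠ 0 := by rintro rfl; simp at hx₀
  have hunit : ∀ x : E, x ≠ 0 → ((‖x‖⁻¹ : ℝ) : ℂ) • x ∈ Metric.sphere (0 : E) 1 := by
    intro x hx
    have : ‖x‖ ≠ 0 := norm_ne_zero_iff.2 hx
    simp [norm_smul, this]
  have hbdd : BddAbove S := by
    refine ⟨‖H‖, ?_⟩
    rintro _ ⟨x, hx, rfl⟩
    have hx1 : ‖x‖ = 1 := by simpa using hx
    calc (inner ℂ (H x) x).re ≤ ‖H x‖ * ‖x‖ := re_inner_le_norm (𝕜 := ℂ) _ _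
      _ ≤ (‖H‖ * ‖x‖) * ‖x‖ := by gcongr; exact H.le_opNorm _
      _ = ‖H‖ := by simp [hx1]
  have hmem₀ := Set.mem_image_of_mem (fun x => (inner ℂ (H x) x).re) (hunit x₀ hx₀')
  have hne : S.Nonempty := ⟨_, hmem₀⟩
  set M := sSup S with hM
  have hM0 : 0 < M := by
    refine lt_of_lt_of_le ?_ (le_csSup hbdd hmem₀)
    have : 0 < ‖x₀‖ := norm_pos_iff.2 hx₀'
    have h2 : 0 < (inner ℂ (H x₀) x₀).re := hx₀
    simp only [hscale]
    positivity
  have hle : ∀ x, (inner ℂ (H x) x).re ≤ M * ‖x‖ ^ 2 := by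
    intro x
    rcases eq_or_ne x 0 with rfl | hx
    · simp
    have h := le_csSup hbdd (Set.mem_image_of_mem (fun x => (inner ℂ (H x) x).re) (hunit x hx))
    simp only [hscale] at h
    have : 0 < ‖x‖ := norm_pos_iff.2 hx
    rw [inv_pow, inv_mul_le_iff₀ (by positivity)] at h
    linarith
  -- The supremum `M` is the candidate eigenvalue: `M - H ≥ 0`, so vectors nearly attaining `M` are
  -- nearly annihilated by `M - H`.
  set B : E →L[ℂ] E := (M : ℂ) • ContinuousLinearMap.id ℂ E - H with hB
  have hHapp : ∀ x, H x = K x - D x := fun x => rfl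
  have hBapp : ∀ x, B x = (M : ℂ) • x - H x := fun x => rfl
  have hself : ∀ x : E, (inner ℂ x x).re = ‖x‖ ^ 2 := fun x => by
    rw [← inner_self_eq_norm_sq (𝕜 := ℂ)]; rfl
  have hBre : ∀ x, (inner ℂ (B x) x).re = M * ‖x‖ ^ 2 - (inner ℂ (H x) x).re := by
    intro x
    rw [hBapp, inner_sub_left, inner_smul_left, Complex.sub_re, Complex.conj_ofReal,
      Complex.re_ofReal_mul, hself]
  have hBsymm : ∀ x y, inner ℂ (B x) y = inner ℂ x (B y) := by
    intro x y
    simp only [hBapp, hHapp, inner_sub_left, inner_sub_right, inner_smul_left, inner_smul_right,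
      hD, hK, Complex.conj_ofReal]
  have hB0 : ∀ x, 0 ≤ (inner ℂ (B x) x).re := fun x => by
    rw [hBre]; linarith [hle x]
  -- a maximizing sequence
  obtain ⟨u, -, hu, huS⟩ := exists_seq_tendsto_sSup hne hbdd
  choose v hv hvu using huS
  have hv1 : ∀ n, ‖v n‖ = 1 := fun n => by simpa using hv n
  have hBv : Tendsto (fun n => B (v n)) atTop (𝓝 0) := by
    rw [tendsto_zero_iff_norm_tendsto_zero]
    have h1 : Tendsto (fun n => (‖B‖ + 1) * (M - u n)) atTop (𝓝 0) := by
      simpa [← hM] using ((tendsto_const_nhds (x := M)).sub hu).const_mul (‖B‖ + 1)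
    have h2 : Tendsto (fun n => ‖B (v n)‖ ^ 2) atTop (𝓝 0) := by
      refine squeeze_zero (fun n => by positivity) (fun n => ?_) h1
      refine (norm_apply_sq_le_of_nonneg B hBsymm hB0 (v n)).trans_eq ?_
      rw [hBre, hv1, ← hvu n]; simp
    simpa using h2.sqrt
  have hcomp : IsCompact (closure (K '' Metric.closedBall 0 1)) :=
    hKc.isCompact_closure_image_closedBall (𝕜₁ := ℂ) (f := (K : E →ₗ[ℂ] E)) 1
  obtain ⟨w, -, φ, hφ, hw⟩ := hcomp.tendsto_subseq (x := fun n => K (v n)) fun n =>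
    subset_closure ⟨v n, by simp [hv1], rfl⟩
  -- coercivity of `M + D`
  set G : E →L[ℂ] E := (M : ℂ) • ContinuousLinearMap.id ℂ E + D with hG
  have hGapp : ∀ x, G x = (M : ℂ) • x + D x := fun x => rfl
  have hcoer : ∀ x, M * ‖x‖ ≤ ‖G x‖ := by
    intro x
    rcases eq_or_ne x 0 with rfl | hx
    · simp
    have h1 : M * ‖x‖ ^ 2 ≤ (inner ℂ (G x) x).re := by
      rw [hGapp, inner_add_left, inner_smul_left, Complex.add_re, Complex.conj_ofReal,
        Complex.re_ofReal_mul, hself]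
      linarith [hD0 x]
    have h2 : (inner ℂ (G x) x).re ≤ ‖G x‖ * ‖x‖ := re_inner_le_norm (𝕜 := ℂ) _ _
    have : 0 < ‖x‖ := norm_pos_iff.2 hx
    by_contra hlt
    push Not at hlt
    nlinarith
  have hanti : AntilipschitzWith (Real.toNNReal M⁻¹) G := by
    refine ContinuousLinearMap.antilipschitz_of_bound G fun x => ?_
    rw [Real.coe_toNNReal _ (inv_nonneg.2 hM0.le), le_inv_mul_iff₀ hM0]
    exact hcoer x
  have hemb := hanti.isClosedEmbedding G.uniformContinuous
  -- `M + D = (M - H) + K`: the first part tends to zero on `v`, the second converges along `φ` by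
  -- compactness. Coercivity of `M + D` then makes `v` itself converge.
  have hGv : Tendsto (fun n => G (v (φ n))) atTop (𝓝 w) := by
    have h := (hBv.comp hφ.tendsto_atTop).add hw
    rw [zero_add] at h
    refine h.congr fun n => ?_
    simp only [Function.comp_apply, hBapp, hHapp, hGapp]
    abel
  obtain ⟨x, hx⟩ : w ∈ Set.range G :=
    hemb.isClosed_range.mem_of_tendsto hGv (Eventually.of_forall fun n => ⟨_, rfl⟩)
  have hvx : Tendsto (fun n => v (φ n)) atTop (𝓝 x) := by
    rw [hemb.isInducing.tendsto_nhds_iff, hx]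
    exact hGv
  refine ⟨M, hM0, x, ?_, ?_⟩
  · have : ‖x‖ = 1 := tendsto_nhds_unique hvx.norm (by simp [hv1])
    rintro rfl
    simp at this
  · have h1 : B x = 0 := tendsto_nhds_unique ((B.continuous.tendsto x).comp hvx)
      (hBv.comp hφ.tendsto_atTop)
    have h2 : (M : ℂ) • x - (K x - D x) = 0 := by rw [← hHapp, ← hBapp, h1]
    exact (sub_eq_zero.1 h2).symm

end Spectral

/-! ### Multiplication, translation and jump operators on `ℓ²` -/

section LpOperators

local notation "ℓ²(" ι ")" => lp (fun _ : ι => ℂ) 2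

lemma summable_norm_sq {ι : Type*} (ψ : ℓ²(ι)) : Summable fun x => ‖ψ x‖ ^ 2 := by
  simpa using (lp.memℓp ψ).summable (by norm_num)

lemma norm_sq_eq_tsum_norm_sq {ι : Type*} (ψ : ℓ²(ι)) : ‖ψ‖ ^ 2 = ∑' x, ‖ψ x‖ ^ 2 := by
  simpa using lp.norm_rpow_eq_tsum (p := 2) (by norm_num) ψ

lemma memℓp_two_of_summable {ι : Type*} {f : ι → ℂ} (hf : Summable fun x => ‖f x‖ ^ 2) :
    Memℓp f 2 := memℓp_gen (by simpa using hf)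

lemma norm_le_of_norm_sq_le {ι : Type*} (ψ : ℓ²(ι)) {g : ι → ℝ} (hg : Summable g) {C : ℝ}
    (hC : 0 ≤ C) (h : ∀ x, ‖ψ x‖ ^ 2 ≤ g x) (hle : ∑' x, g x ≤ C ^ 2) : ‖ψ‖ ≤ C := by
  refine le_of_sq_le_sq ?_ hC
  rw [norm_sq_eq_tsum_norm_sq]
  exact ((summable_norm_sq ψ).tsum_le_tsum h hg).trans hle

/-- Multiplication by a bounded real function on `ℓ²`. -/
noncomputable def mulOp {ι : Type*} (V : ι → ℝ) {C : ℝ} (hV : ∀ x, |V x| ≤ C) :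
    ℓ²(ι) →L[ℂ] ℓ²(ι) :=
  have key : ∀ (ψ : ℓ²(ι)) x, ‖(V x : ℂ) * ψ x‖ ^ 2 ≤ C ^ 2 * ‖ψ x‖ ^ 2 := fun ψ x => by
    rw [norm_mul, mul_pow, Complex.norm_real, Real.norm_eq_abs]
    gcongr
    exact hV x
  LinearMap.mkContinuous
    { toFun := fun ψ => ⟨fun x => (V x : ℂ) * ψ x, memℓp_two_of_summable
        (.of_nonneg_of_le (fun _ => by positivity) (key ψ) ((summable_norm_sq ψ).mul_left _))⟩
      map_add' := fun φ ψ => lp.ext (funext fun x => mul_add _ _ _)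
      map_smul' := fun c ψ => lp.ext (funext fun x => mul_left_comm _ _ _) }
    |C| fun ψ => by
      refine norm_le_of_norm_sq_le _ ((summable_norm_sq ψ).mul_left (C ^ 2)) (by positivity)
        (key ψ) ?_
      rw [tsum_mul_left, mul_pow, sq_abs, norm_sq_eq_tsum_norm_sq]

@[simp] lemma mulOp_apply {ι : Type*} (V : ι → ℝ) {C : ℝ} (hV : ∀ x, |V x| ≤ C) (ψ : ℓ²(ι))
    (x : ι) : mulOp V hV ψ x = (V x : ℂ) * ψ x := rfl

lemma inner_mulOp {ι : Type*} (V : ι → ℝ) {C : ℝ} (hV : ∀ x, |V x| ≤ C) (φ ψ : ℓ²(ι)) :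
    inner ℂ (mulOp V hV φ) ψ = inner ℂ φ (mulOp V hV ψ) := by
  simp only [lp.inner_eq_tsum, mulOp_apply]
  refine tsum_congr fun x => ?_
  simp only [RCLike.inner_apply, map_mul, Complex.conj_ofReal]
  ring

lemma hasSum_re_inner_mulOp {ι : Type*} (V : ι → ℝ) {C : ℝ} (hV : ∀ x, |V x| ≤ C)
    (ψ : ℓ²(ι)) : HasSum (fun x => V x * ‖ψ x‖ ^ 2) (inner ℂ (mulOp V hV ψ) ψ).re := by
  refine (Complex.hasSum_re (lp.hasSum_inner (mulOp V hV ψ) ψ)).congr_fun fun x => ?_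
  have h : inner ℂ ((V x : ℂ) * ψ x) (ψ x) = ((V x * ‖ψ x‖ ^ 2 : ℝ) : ℂ) := by
    rw [RCLike.inner_apply, map_mul, Complex.conj_ofReal, mul_left_comm, Complex.mul_conj']
    push_cast
    rfl
  rw [mulOp_apply, h, Complex.ofReal_re]

/-- Multiplication by a function that vanishes at infinity is compact on `ℓ²`. -/
lemma isCompactOperator_mulOp {ι : Type*} (V : ι → ℝ) {C : ℝ} (hV : ∀ x, |V x| ≤ C)
    (h0 : Tendsto V cofinite (𝓝 0)) : IsCompactOperator (mulOp V hV) := by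
  classical
  -- Finite-rank truncations to `F`; they converge in operator norm because the error is at most the
  -- supremum of `|V|` off `F`.
  let P : Finset ι → (ℓ²(ι) →L[ℂ] ℓ²(ι)) := fun F => ∑ x ∈ F, (V x : ℂ) •
    (lp.singleContinuousLinearMap ℂ (fun _ : ι => ℂ) 2 x ∘L lp.evalCLM ℂ (fun _ : ι => ℂ) 2 x)
  have hP : ∀ F (ψ : ℓ²(ι)) y, P F ψ y = if y ∈ F then (V y : ℂ) * ψ y else 0 := by
    intro F ψ y
    have : P F ψ y = ∑ x ∈ F, (V x : ℂ) * (lp.single 2 x (ψ x) : ℓ²(ι)) y := by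
      simp only [P, sum_apply, lp.coeFn_sum, Finset.sum_apply]
      rfl
    rw [this]
    simp only [lp.single_apply, Pi.single_apply, mul_ite, mul_zero, Finset.sum_ite_eq]
  refine isCompactOperator_of_tendsto (l := atTop) (F := P) ?_ (Eventually.of_forall fun F => ?_)
  · rw [Metric.tendsto_nhds]
    intro ε hε
    have hfin : {x | ¬ |V x| < ε / 2}.Finite := by
      have := h0.abs.eventually (gt_mem_nhds (by simpa using half_pos hε : |(0 : ℝ)| < ε / 2))
      exact this
    filter_upwards [eventually_ge_atTop hfin.toFinset] with F hF
    rw [dist_eq_norm]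
    refine lt_of_le_of_lt ?_ (half_lt_self hε)
    refine ContinuousLinearMap.opNorm_le_bound _ (by positivity) fun ψ => ?_
    refine norm_le_of_norm_sq_le _ ((summable_norm_sq ψ).mul_left ((ε / 2) ^ 2)) (by positivity)
      (fun y => ?_) ?_
    · have : (P F - mulOp V hV) ψ y = P F ψ y - mulOp V hV ψ y := rfl
      rw [this, hP, mulOp_apply]
      split_ifs with hy
      · simp; positivity
      · have hy' : |V y| < ε / 2 := by
          by_contra hc
          exact hy (hF (by simpa using hc))
        rw [zero_sub, norm_neg, norm_mul, mul_pow, Complex.norm_real, Real.norm_eq_abs]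
        gcongr
    · rw [tsum_mul_left, mul_pow, norm_sq_eq_tsum_norm_sq]
  · have hrank : ∀ x, IsCompactOperator ((V x : ℂ) •
        (lp.singleContinuousLinearMap ℂ (fun _ : ι => ℂ) 2 x ∘L
          lp.evalCLM ℂ (fun _ : ι => ℂ) 2 x)) := fun x =>
      ((isCompactOperator_of_locallyCompactSpace_dom (M₂ := ℂ)
        (lp.evalCLM ℂ (fun _ : ι => ℂ) 2 x)).clm_comp
        (lp.singleContinuousLinearMap ℂ (fun _ : ι => ℂ) 2 x)).smul (V x : ℂ)
    exact Submodule.sum_mem (compactOperator (RingHom.id ℂ) ℓ²(ι) ℓ²(ι))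
      (f := fun x => ((V x : ℂ) • (lp.singleContinuousLinearMap ℂ (fun _ : ι => ℂ) 2 x ∘L
          lp.evalCLM ℂ (fun _ : ι => ℂ) 2 x) : ℓ²(ι) →L[ℂ] ℓ²(ι)) ) fun x _ => hrank x

variable {G : Type*} [AddCommGroup G]

lemma summable_norm_sq_add_right (ψ : ℓ²(G)) (z : G) : Summable fun x => ‖ψ (x + z)‖ ^ 2 :=
  (summable_norm_sq ψ).comp_injective (add_left_injective z)

/-- The translation `ψ ↦ ψ(· + z)` on `ℓ²`. -/
noncomputable def shiftOp (z : G) : ℓ²(G) →L[ℂ] ℓ²(G) :=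
  LinearMap.mkContinuous
    { toFun := fun ψ => ⟨fun x => ψ (x + z),
        memℓp_two_of_summable (summable_norm_sq_add_right ψ z)⟩
      map_add' := fun φ ψ => rfl
      map_smul' := fun c ψ => rfl }
    1 fun ψ => by
      refine norm_le_of_norm_sq_le _ (summable_norm_sq_add_right ψ z) (by positivity)
        (fun x => le_rfl) ?_
      rw [one_mul, norm_sq_eq_tsum_norm_sq]
      exact ((Equiv.addRight z).tsum_eq (fun x => ‖ψ x‖ ^ 2)).le

@[simp] lemma shiftOp_apply (z : G) (ψ : ℓ²(G)) (x : G) : shiftOp z ψ x = ψ (x + z) := rfl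

lemma norm_shiftOp_le (z : G) : ‖shiftOp z‖ ≤ 1 := LinearMap.mkContinuous_norm_le _ zero_le_one _

lemma norm_shiftOp_apply (z : G) (ψ : ℓ²(G)) : ‖shiftOp z ψ‖ = ‖ψ‖ := by
  rw [← sq_eq_sq₀ (norm_nonneg _) (norm_nonneg _), norm_sq_eq_tsum_norm_sq,
    norm_sq_eq_tsum_norm_sq]
  exact (Equiv.addRight z).tsum_eq (fun x => ‖ψ x‖ ^ 2)

lemma inner_shiftOp (z : G) (φ ψ : ℓ²(G)) :
    inner ℂ (shiftOp z φ) ψ = inner ℂ φ (shiftOp (-z) ψ) := by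
  simp only [lp.inner_eq_tsum, shiftOp_apply]
  rw [← (Equiv.addRight z).tsum_eq (fun x => inner ℂ (φ x) (ψ (x + -z)))]
  simp

variable {a : G → ℝ}

lemma summable_smul_shiftOp (ha : Summable a) (ha0 : ∀ z, 0 ≤ a z) :
    Summable fun z => (a z : ℂ) • shiftOp (G := G) z := by
  refine .of_norm_bounded ha fun z => ?_
  rw [norm_smul, Complex.norm_real, Real.norm_of_nonneg (ha0 z)]
  exact mul_le_of_le_one_right (ha0 z) (norm_shiftOp_le z)

/-- The generator `ψ ↦ ψ - ∑_z a(z) ψ(· + z)` with the sign that makes it nonnegative. -/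
noncomputable def jumpOp (a : G → ℝ) : ℓ²(G) →L[ℂ] ℓ²(G) :=
  ContinuousLinearMap.id ℂ _ - ∑' z, (a z : ℂ) • shiftOp z

lemma hasSum_shiftOp_apply (ha : Summable a) (ha0 : ∀ z, 0 ≤ a z) (ψ : ℓ²(G)) :
    HasSum (fun z => (a z : ℂ) • shiftOp z ψ) (ψ - jumpOp a ψ) := by
  have h := (ContinuousLinearMap.apply ℂ ℓ²(G) ψ).hasSum (summable_smul_shiftOp ha ha0).hasSum
  have h2 : ψ - jumpOp a ψ = (∑' z, (a z : ℂ) • shiftOp z) ψ := sub_sub_cancel _ _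
  rw [h2]
  exact h

lemma inner_jumpOp (ha : Summable a) (ha0 : ∀ z, 0 ≤ a z) (hs : ∀ z, a (-z) = a z)
    (φ ψ : ℓ²(G)) : inner ℂ (jumpOp a φ) ψ = inner ℂ φ (jumpOp a ψ) := by
  have h1 : HasSum (fun z => inner ℂ ((a z : ℂ) • shiftOp z φ) ψ) (inner ℂ (φ - jumpOp a φ) ψ) :=
    (innerSLFlip ℂ ψ).hasSum (hasSum_shiftOp_apply ha ha0 φ)
  have h2 : HasSum (fun z => inner ℂ φ ((a z : ℂ) • shiftOp z ψ)) (inner ℂ φ (ψ - jumpOp a ψ)) :=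
    (innerSL ℂ φ).hasSum (hasSum_shiftOp_apply ha ha0 ψ)
  -- The adjoint of translation by `z` is translation by `-z`, so symmetry of `a` matches the two
  -- series after `z ↦ -z`.
  rw [← (Equiv.neg G).hasSum_iff] at h2
  have h3 := h1.unique (h2.congr_fun fun z => by
    simp only [inner_smul_left, inner_smul_right, inner_shiftOp, hs, Complex.conj_ofReal,
      Function.comp_apply, Equiv.neg_apply])
  simpa [inner_sub_left, inner_sub_right] using h3

/-- The Dirichlet form: expand the square, using that translations are isometric and that `a` has
total mass one. It yields nonnegativity, the upper bound on the form and its Fourier representation.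
-/
lemma hasSum_norm_sq_shiftOp_sub (ha : HasSum a 1) (ha0 : ∀ z, 0 ≤ a z) (ψ : ℓ²(G)) :
    HasSum (fun z => a z * ‖shiftOp z ψ - ψ‖ ^ 2) (2 * (inner ℂ (jumpOp a ψ) ψ).re) := by
  have h1 : HasSum (fun z => inner ℂ ((a z : ℂ) • shiftOp z ψ) ψ) (inner ℂ (ψ - jumpOp a ψ) ψ) :=
    (innerSLFlip ℂ ψ).hasSum (hasSum_shiftOp_apply ha.summable ha0 ψ)
  have h2 := ((ha.mul_right (‖ψ‖ ^ 2)).sub (Complex.hasSum_re h1)).mul_left 2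
  have hself : (inner ℂ ψ ψ).re = ‖ψ‖ ^ 2 := by
    rw [← inner_self_eq_norm_sq (𝕜 := ℂ)]; rfl
  have h3 : 2 * (1 * ‖ψ‖ ^ 2 - (inner ℂ (ψ - jumpOp a ψ) ψ).re) =
      2 * (inner ℂ (jumpOp a ψ) ψ).re := by
    rw [inner_sub_left, Complex.sub_re, hself]; ring
  rw [h3] at h2
  refine h2.congr_fun fun z => ?_
  rw [norm_sub_sq (𝕜 := ℂ), norm_shiftOp_apply, inner_smul_left, Complex.conj_ofReal,
    Complex.re_ofReal_mul, RCLike.re_to_complex]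
  ring

lemma re_inner_jumpOp_nonneg (ha : HasSum a 1) (ha0 : ∀ z, 0 ≤ a z) (ψ : ℓ²(G)) :
    0 ≤ (inner ℂ (jumpOp a ψ) ψ).re := by
  have := (hasSum_norm_sq_shiftOp_sub ha ha0 ψ).nonneg fun z => mul_nonneg (ha0 z) (by positivity)
  linarith

lemma hasSum_jumpOp_apply (ha : HasSum a 1) (ha0 : ∀ z, 0 ≤ a z) (ψ : ℓ²(G)) (x : G) :
    HasSum (fun z => (a z : ℂ) * (ψ (x + z) - ψ x)) (-(jumpOp a ψ x)) := by
  have h1 : HasSum (fun z => (a z : ℂ) * ψ (x + z)) (ψ x - jumpOp a ψ x) :=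
    (lp.evalCLM ℂ (fun _ : G => ℂ) 2 x).hasSum (hasSum_shiftOp_apply ha.summable ha0 ψ)
  have h2 := h1.sub ((Complex.hasSum_ofReal.2 ha).mul_right (ψ x))
  rw [Complex.ofReal_one, one_mul, sub_sub_cancel_left] at h2
  exact h2.congr_fun fun z => mul_sub _ _ _

end LpOperators

/-- The eigenvalue equation in operator form. -/
lemma isSchrodingerEigenvalue_iff {d : ℕ} {a : (Fin d → ℤ) → ℝ} (ha : IsJumpDistribution a)
    (V : (Fin d → ℤ) → ℝ) {C : ℝ} (hV : ∀ x, |V x| ≤ C) (σ lam : ℝ) :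
    IsSchrodingerEigenvalue a V σ lam ↔ ∃ ψ : lp (fun _ : Fin d → ℤ => ℂ) 2, ψ ≠ 0 ∧
      ((σ : ℂ) • mulOp V hV) ψ - jumpOp a ψ = (lam : ℂ) • ψ := by
  refine exists_congr fun ψ => and_congr_right fun _ => ?_
  rw [lp.ext_iff, funext_iff]
  refine forall_congr' fun x => ?_
  have h := (hasSum_jumpOp_apply ha.hasSum_one ha.nonneg ψ x).tsum_eq
  simp only [schrodingerOp, nonlocalLaplacian, h]
  have h1 : (((σ : ℂ) • mulOp V hV) ψ - jumpOp a ψ) x =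
    (σ : ℂ) * ((V x : ℂ) * ψ x) - jumpOp a ψ x := rfl
  have h2 : ((lam : ℂ) • ψ : lp (fun _ : Fin d → ℤ => ℂ) 2) x = (lam : ℂ) * ψ x := rfl
  rw [h1, h2, ← mul_assoc, neg_add_eq_sub]

/-! ### Dyadic proof of the weighted Sobolev inequality -/

section WeightedSobolev

open MeasureTheory
open scoped ENNReal

lemma ENNReal.exists_two_inv_pow_lt_and_le {t : ℝ≥0∞} (h0 : t ≠ 0) (h1 : t ≤ 1) :
    ∃ n : ℕ, (2⁻¹ : ℝ≥0∞) ^ (n + 1) < t ∧ t ≤ 2⁻¹ ^ n := by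
  have hex : ∃ n : ℕ, (2⁻¹ : ℝ≥0∞) ^ n < t :=
    ((ENNReal.tendsto_pow_atTop_nhds_zero_of_lt_one (by simp)).eventually
      (gt_mem_nhds (pos_iff_ne_zero.2 h0))).exists
  classical
  have hspec := Nat.find_spec hex
  obtain ⟨n, hn⟩ : ∃ n, Nat.find hex = n + 1 := by
    refine Nat.exists_eq_succ_of_ne_zero fun h => ?_
    rw [h, pow_zero] at hspec
    exact absurd hspec (not_lt.2 h1)
  refine ⟨n, hn ▸ hspec, not_lt.1 (Nat.find_min hex (by omega))⟩

/-- The surviving terms form a geometric series whose first term is at most `t`. Taken at `t =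
s(k)`, this sums the high-frequency parts over all cut-offs. -/
lemma ENNReal.tsum_two_inv_pow_indicator_le (t : ℝ≥0∞) :
    ∑' n : ℕ, (if (2⁻¹ : ℝ≥0∞) ^ n ≤ t then (2⁻¹ : ℝ≥0∞) ^ n else 0) ≤ 2 * t := by
  classical
  by_cases hex : ∃ n : ℕ, (2⁻¹ : ℝ≥0∞) ^ n ≤ t
  swap
  · push Not at hex
    simp [fun n => not_le.2 (hex n)]
  set n₀ := Nat.find hex
  have hspec : (2⁻¹ : ℝ≥0∞) ^ n₀ ≤ t := Nat.find_spec hex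
  rw [← Summable.sum_add_tsum_nat_add' (k := n₀) ENNReal.summable]
  rw [Finset.sum_eq_zero fun i hi => if_neg (Nat.find_min hex (Finset.mem_range.1 hi)), zero_add]
  calc ∑' n : ℕ, (if (2⁻¹ : ℝ≥0∞) ^ (n + n₀) ≤ t then (2⁻¹ : ℝ≥0∞) ^ (n + n₀) else 0)
      ≤ ∑' n : ℕ, (2⁻¹ : ℝ≥0∞) ^ n * 2⁻¹ ^ n₀ := by
        refine ENNReal.tsum_le_tsum fun n => ?_
        rw [← pow_add]
        split_ifs <;> simp
    _ = 2 * 2⁻¹ ^ n₀ := by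
        rw [ENNReal.tsum_mul_right, ENNReal.tsum_geometric, ENNReal.one_sub_inv_two, inv_inv]
    _ ≤ 2 * t := by gcongr

lemma ENNReal.rpow_two_inv_pow (p : ℝ) (n : ℕ) :
    ((2⁻¹ : ℝ≥0∞) ^ n) ^ p = (2⁻¹ ^ p) ^ n := by
  rw [← ENNReal.rpow_natCast, ← ENNReal.rpow_natCast, ← ENNReal.rpow_mul, ← ENNReal.rpow_mul,
    mul_comm]

variable {T : Type*} [MeasurableSpace T] {μ : Measure T}

/-- A weight whose sublevel sets satisfy `μ {s ≤ r} ≤ C r ^ p` with `p > 1` has an integrable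
inverse on them. -/
lemma lintegral_inv_lt_le {s : T → ℝ≥0∞} (hs : Measurable s) {C : ℝ≥0∞} {p : ℝ} (hp : 1 < p)
    (hμ : ∀ r, μ {t | s t ≤ r} ≤ C * r ^ p) (n : ℕ) :
    ∫⁻ t in {t | s t < 2⁻¹ ^ n}, (s t)⁻¹ ∂μ ≤
      2 * C * (1 - 2⁻¹ ^ (p - 1))⁻¹ * (2⁻¹ ^ n) ^ (p - 1) := by
  -- The case `r = 0` of the sublevel bound.
  have hzero : ∀ᵐ t ∂μ, s t ≠ 0 := by
    have := hμ 0
    rw [ENNReal.zero_rpow_of_pos (by linarith), mul_zero, nonpos_iff_eq_zero] at this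
    rw [ae_iff]
    convert this using 3 with t
    simp
  -- On the layer `2⁻¹ ^ (k + 1) < s ≤ 2⁻¹ ^ k` the inverse is below `2 ^ (k + 1)`. The layer
  -- contributes a multiple of `(2⁻¹ ^ k) ^ (p - 1)`, geometric in `k` since `p > 1`.
  have hpt : ∀ᵐ t ∂μ.restrict {t | s t < 2⁻¹ ^ n}, (s t)⁻¹ ≤
      ∑' m : ℕ, {t | s t ≤ 2⁻¹ ^ (n + m)}.indicator
        (fun _ => ((2⁻¹ : ℝ≥0∞) ^ (n + m + 1))⁻¹) t := by
    filter_upwards [ae_restrict_of_ae hzero,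
      ae_restrict_mem (measurableSet_lt hs measurable_const)] with t ht0 ht
    have ht : s t < 2⁻¹ ^ n := ht
    obtain ⟨k, hk1, hk2⟩ := ENNReal.exists_two_inv_pow_lt_and_le ht0
      (ht.le.trans (pow_le_one' (by simp) _))
    have hnk : n ≤ k := by
      by_contra hlt
      push Not at hlt
      exact absurd (hk1.trans ht) (not_lt.2 (pow_le_pow_right_of_le_one' (by simp) hlt))
    obtain ⟨m, rfl⟩ := Nat.exists_eq_add_of_le hnk
    refine le_trans ?_ (ENNReal.le_tsum m)
    rw [Set.indicator_of_mem (by exact hk2)]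
    exact ENNReal.inv_le_inv.2 hk1.le
  refine (lintegral_mono_ae hpt).trans ?_
  refine (lintegral_mono' Measure.restrict_le_self le_rfl).trans ?_
  rw [lintegral_tsum fun m => (measurable_const.indicator
    (measurableSet_le hs measurable_const)).aemeasurable]
  have hterm : ∀ m : ℕ, ∫⁻ t, {t | s t ≤ 2⁻¹ ^ (n + m)}.indicator
        (fun _ => ((2⁻¹ : ℝ≥0∞) ^ (n + m + 1))⁻¹) t ∂μ ≤
      2 * C * (2⁻¹ ^ n) ^ (p - 1) * (2⁻¹ ^ (p - 1)) ^ m := by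
    intro m
    rw [lintegral_indicator_const (measurableSet_le hs measurable_const)]
    set x : ℝ≥0∞ := 2⁻¹ ^ (n + m) with hx
    have hx0 : x ≠ 0 := by simp [hx]
    have hxt : x ≠ ∞ := ENNReal.pow_ne_top (by simp)
    calc ((2⁻¹ : ℝ≥0∞) ^ (n + m + 1))⁻¹ * μ {t | s t ≤ x} ≤ (2 * x⁻¹) * (C * x ^ p) := by
          gcongr
          · rw [pow_succ, ENNReal.mul_inv (by simp) (by simp), inv_inv, mul_comm]
          · exact hμ x
      _ = 2 * C * (x⁻¹ * x ^ p) := by ring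
      _ = 2 * C * x ^ (p - 1) := by
          rw [sub_eq_neg_add, ENNReal.rpow_add _ _ hx0 hxt, ENNReal.rpow_neg_one]
      _ = _ := by
          rw [hx, pow_add, ENNReal.mul_rpow_of_nonneg _ _ (by linarith),
            ENNReal.rpow_two_inv_pow _ m, mul_assoc _ _ ((2⁻¹ ^ (p - 1)) ^ m)]
  refine (ENNReal.tsum_le_tsum hterm).trans_eq ?_
  rw [ENNReal.tsum_mul_left, ENNReal.tsum_geometric]
  ring

/-- Cauchy–Schwarz for `g = s^(-1/2) · (s^(1/2) g)`. -/
lemma sq_setLIntegral_le_mul {s g : T → ℝ≥0∞} (hs : Measurable s) (hg : AEMeasurable g μ)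
    {S : Set T} (hs0 : ∀ᵐ t ∂μ.restrict S, s t ≠ 0) (hst : ∀ᵐ t ∂μ.restrict S, s t ≠ ∞) :
    (∫⁻ t in S, g t ∂μ) ^ 2 ≤ (∫⁻ t in S, (s t)⁻¹ ∂μ) * ∫⁻ t, s t * g t ^ 2 ∂μ := by
  have h := ENNReal.lintegral_mul_norm_pow_le (μ := μ.restrict S) (p := 2⁻¹) (q := 2⁻¹)
    (f := fun t => (s t)⁻¹) (g := fun t => s t * g t ^ 2) hs.inv.aemeasurable
    (hs.aemeasurable.mul (hg.restrict.pow_const 2)) (by norm_num) (by norm_num) (by norm_num)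
  have heq : ∫⁻ t in S, g t ∂μ =
      ∫⁻ t in S, (s t)⁻¹ ^ (2⁻¹ : ℝ) * (s t * g t ^ 2) ^ (2⁻¹ : ℝ) ∂μ := by
    refine lintegral_congr_ae ?_
    filter_upwards [hs0, hst] with t h0 ht
    rw [← ENNReal.mul_rpow_of_nonneg _ _ (by norm_num), ← mul_assoc,
      ENNReal.inv_mul_cancel h0 ht, one_mul, ← ENNReal.rpow_two, ← ENNReal.rpow_mul]
    norm_num
  rw [← heq] at h
  calc (∫⁻ t in S, g t ∂μ) ^ 2
      ≤ ((∫⁻ t in S, (s t)⁻¹ ∂μ) ^ (2⁻¹ : ℝ) *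
          (∫⁻ t in S, s t * g t ^ 2 ∂μ) ^ (2⁻¹ : ℝ)) ^ 2 := by gcongr
    _ = (∫⁻ t in S, (s t)⁻¹ ∂μ) * ∫⁻ t in S, s t * g t ^ 2 ∂μ := by
        rw [mul_pow, ← ENNReal.rpow_two, ← ENNReal.rpow_two, ← ENNReal.rpow_mul,
          ← ENNReal.rpow_mul]
        norm_num
    _ ≤ _ := by gcongr; exact Measure.restrict_le_self

lemma enorm_add_sq_le {E : Type*} [SeminormedAddCommGroup E] (x y : E) :
    ‖x + y‖ₑ ^ 2 ≤ 2 * ‖x‖ₑ ^ 2 + 2 * ‖y‖ₑ ^ 2 := by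
  have h : ‖x + y‖ ^ 2 ≤ 2 * ‖x‖ ^ 2 + 2 * ‖y‖ ^ 2 := by
    nlinarith [norm_add_le x y, norm_nonneg (x + y), sq_nonneg (‖x‖ - ‖y‖), norm_nonneg x,
      norm_nonneg y]
  have := ENNReal.ofReal_le_ofReal h
  rw [ENNReal.ofReal_add (by positivity) (by positivity), ENNReal.ofReal_mul zero_le_two,
    ENNReal.ofReal_mul zero_le_two] at this
  simpa [ENNReal.ofReal_pow] using this

/-- Weighted Sobolev (Cwikel type) inequality: if `e x` is a Bessel system of functions bounded
by one, `μ {s ≤ r} ≤ C r ^ p` with `p > 1`, and `W ≤ 1` is in `ℓ^p`, then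
`∑ W(x) |⟨e x, f⟩|² ≤ K ∫ s |f|²` with `K` independent of `f`. -/
theorem exists_tsum_mul_enorm_integral_sq_le {ι : Type*} (e : ι → T → ℂ)
    (he : ∀ x t, ‖e x t‖ₑ ≤ 1) (hem : ∀ x, Measurable (e x)) [IsFiniteMeasure μ]
    (bessel : ∀ f : T → ℂ, MemLp f 2 μ →
      ∑' x, ‖∫ t, e x t * f t ∂μ‖ₑ ^ 2 ≤ ∫⁻ t, ‖f t‖ₑ ^ 2 ∂μ)
    {s : T → ℝ≥0∞} (hs : Measurable s) {C : ℝ≥0∞} (hC : C ≠ ∞) {p : ℝ} (hp : 1 < p)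
    (hμ : ∀ r, μ {t | s t ≤ r} ≤ C * r ^ p)
    {W : ι → ℝ≥0∞} (hW1 : ∀ x, W x ≤ 1) (hWp : ∑' x, W x ^ p ≠ ∞) :
    ∃ K : ℝ≥0∞, K ≠ ∞ ∧ ∀ f : T → ℂ, MemLp f 2 μ →
      ∑' x, W x * ‖∫ t, e x t * f t ∂μ‖ₑ ^ 2 ≤ K * ∫⁻ t, s t * ‖f t‖ₑ ^ 2 ∂μ := by
  set A : ℝ≥0∞ := 2 * C * (1 - 2⁻¹ ^ (p - 1))⁻¹ with hA
  have hA' : A ≠ ∞ := by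
    refine ENNReal.mul_ne_top (ENNReal.mul_ne_top (by simp) hC) (ENNReal.inv_ne_top.2 ?_)
    exact (tsub_pos_of_lt (ENNReal.rpow_lt_one (by simp) (by linarith))).ne'
  -- Squaring a sum of two parts costs 2. The low part adds `A` and, from `2⁻¹ ^ n ≤ 2 W x`, the
  -- factor `2 ^ (p - 1)`; the high part adds another 2.
  refine ⟨2 * (A * 2 ^ (p - 1)) * ∑' x, W x ^ p + 4, ?_, fun f hf => ?_⟩
  · refine ENNReal.add_ne_top.2 ⟨ENNReal.mul_ne_top (ENNReal.mul_ne_top (by simp)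
      (ENNReal.mul_ne_top hA' (ENNReal.rpow_ne_top_of_nonneg (by linarith) (by simp)))) hWp,
      by simp⟩
  set N := ∫⁻ t, s t * ‖f t‖ₑ ^ 2 ∂μ with hN
  have hzero : ∀ᵐ t ∂μ, s t ≠ 0 := by
    have := hμ 0
    rw [ENNReal.zero_rpow_of_pos (by linarith), mul_zero, nonpos_iff_eq_zero] at this
    rw [ae_iff]
    convert this using 3 with t
    simp
  let S : ℕ → Set T := fun n => {t | s t < 2⁻¹ ^ n}
  have hS : ∀ n, MeasurableSet (S n) := fun n => measurableSet_lt hs measurable_const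
  -- low frequencies
  have hlow : ∀ n x, ‖∫ t in S n, e x t * f t ∂μ‖ₑ ^ 2 ≤ A * (2⁻¹ ^ n) ^ (p - 1) * N := by
    intro n x
    calc ‖∫ t in S n, e x t * f t ∂μ‖ₑ ^ 2 ≤ (∫⁻ t in S n, ‖f t‖ₑ ∂μ) ^ 2 := by
          gcongr
          refine (enorm_integral_le_lintegral_enorm _).trans (lintegral_mono fun t => ?_)
          rw [enorm_mul]
          exact mul_le_of_le_one_left' (he x t)
      _ ≤ (∫⁻ t in S n, (s t)⁻¹ ∂μ) * N :=
          sq_setLIntegral_le_mul hs hf.1.enorm (ae_restrict_of_ae hzero) (by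
            filter_upwards [ae_restrict_mem (hS n)] with t ht
            exact ne_top_of_lt ht)
      _ ≤ _ := by gcongr; exact lintegral_inv_lt_le hs hp hμ n
  -- high frequencies
  have hhigh : ∀ n, ∑' x, ‖∫ t in (S n)ᶜ, e x t * f t ∂μ‖ₑ ^ 2 ≤
      ∫⁻ t in (S n)ᶜ, ‖f t‖ₑ ^ 2 ∂μ := by
    intro n
    have h := bessel ((S n)ᶜ.indicator f) (hf.indicator (hS n).compl)
    convert h using 1
    · refine tsum_congr fun x => ?_
      rw [← integral_indicator (hS n).compl]
      congr 3
      ext t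
      by_cases ht : t ∈ (S n)ᶜ <;> simp [ht]
    · rw [← lintegral_indicator (hS n).compl]
      congr 1
      ext t
      by_cases ht : t ∈ (S n)ᶜ <;> simp [ht]
  have hsum_high : ∑' n : ℕ, 2⁻¹ ^ n * ∫⁻ t in (S n)ᶜ, ‖f t‖ₑ ^ 2 ∂μ ≤ 2 * N := by
    have hm : AEMeasurable (fun t => ‖f t‖ₑ ^ 2) μ := hf.1.enorm.pow_const 2
    calc ∑' n : ℕ, 2⁻¹ ^ n * ∫⁻ t in (S n)ᶜ, ‖f t‖ₑ ^ 2 ∂μ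
        = ∑' n : ℕ, ∫⁻ t, (S n)ᶜ.indicator (fun t => 2⁻¹ ^ n * ‖f t‖ₑ ^ 2) t ∂μ := by
          refine tsum_congr fun n => ?_
          rw [lintegral_indicator (hS n).compl, lintegral_const_mul'' _ hm.restrict]
      _ = ∫⁻ t, ∑' n : ℕ, (S n)ᶜ.indicator (fun t => 2⁻¹ ^ n * ‖f t‖ₑ ^ 2) t ∂μ := by
          rw [lintegral_tsum fun n => (hm.const_mul _).indicator (hS n).compl]
      _ ≤ ∫⁻ t, 2 * (s t * ‖f t‖ₑ ^ 2) ∂μ := by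
          refine lintegral_mono fun t => ?_
          have : ∀ n : ℕ, (S n)ᶜ.indicator (fun t => 2⁻¹ ^ n * ‖f t‖ₑ ^ 2) t =
              (if (2⁻¹ : ℝ≥0∞) ^ n ≤ s t then (2⁻¹ : ℝ≥0∞) ^ n else 0) * ‖f t‖ₑ ^ 2 := by
            intro n
            simp [S, Set.indicator_apply]
          simp only [this]
          rw [ENNReal.tsum_mul_right, ← mul_assoc]
          gcongr
          exact ENNReal.tsum_two_inv_pow_indicator_le _
      _ = 2 * N := by rw [lintegral_const_mul' _ _ (by simp)]
  have hint : ∀ x, Integrable (fun t => e x t * f t) μ := fun x =>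
    (hf.integrable one_le_two).bdd_mul (c := 1) (hem x).aestronglyMeasurable
      (Eventually.of_forall fun t => by
        have := he x t
        rwa [← ofReal_norm, ENNReal.ofReal_le_one] at this)
  -- pointwise splitting
  have hpt : ∀ x, W x * ‖∫ t, e x t * f t ∂μ‖ₑ ^ 2 ≤
      2 * (A * 2 ^ (p - 1)) * W x ^ p * N +
        2 * ∑' n : ℕ, 2⁻¹ ^ n * ‖∫ t in (S n)ᶜ, e x t * f t ∂μ‖ₑ ^ 2 := by
    intro x
    rcases eq_or_ne (W x) 0 with h0 | h0
    · simp [h0]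
    obtain ⟨n, hn1, hn2⟩ := ENNReal.exists_two_inv_pow_lt_and_le h0 (hW1 x)
    have hWt : W x ≠ ∞ := ne_top_of_le_ne_top ENNReal.one_ne_top (hW1 x)
    rw [← integral_add_compl (hS n) (hint x)]
    refine (mul_le_mul_right (enorm_add_sq_le _ _) _).trans ?_
    rw [mul_add]
    refine add_le_add ?_ ?_
    · have hq : ((2⁻¹ : ℝ≥0∞) ^ n) ≤ 2 * W x := by
        calc (2⁻¹ : ℝ≥0∞) ^ n = 2 * 2⁻¹ ^ (n + 1) := by
              rw [pow_succ', ← mul_assoc, ENNReal.mul_inv_cancel (by simp) (by simp), one_mul]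
          _ ≤ 2 * W x := by gcongr
      calc W x * (2 * ‖∫ t in S n, e x t * f t ∂μ‖ₑ ^ 2)
          ≤ W x * (2 * (A * (2 * W x) ^ (p - 1) * N)) := by
            gcongr
            refine (hlow n x).trans ?_
            gcongr
        _ = 2 * (A * 2 ^ (p - 1)) * (W x * W x ^ (p - 1)) * N := by
            rw [ENNReal.mul_rpow_of_nonneg _ _ (by linarith)]; ring
        _ = _ := by
            congr 2
            nth_rewrite 1 [← ENNReal.rpow_one (W x)]
            rw [← ENNReal.rpow_add _ _ h0 hWt]
            congr 1
            ring
    -- Here `W x ≤ 2⁻¹ ^ n`; bounding the term `n` by the sum over all levels removes the dependence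
    -- of the cut-off on `x`.
    · rw [mul_left_comm]
      gcongr
      refine le_trans ?_ (ENNReal.le_tsum n)
      gcongr
  calc ∑' x, W x * ‖∫ t, e x t * f t ∂μ‖ₑ ^ 2
      ≤ ∑' x, (2 * (A * 2 ^ (p - 1)) * W x ^ p * N +
        2 * ∑' n : ℕ, 2⁻¹ ^ n * ‖∫ t in (S n)ᶜ, e x t * f t ∂μ‖ₑ ^ 2) := ENNReal.tsum_le_tsum hpt
    _ = 2 * (A * 2 ^ (p - 1)) * (∑' x, W x ^ p) * N +
        2 * ∑' n : ℕ, 2⁻¹ ^ n * ∑' x, ‖∫ t in (S n)ᶜ, e x t * f t ∂μ‖ₑ ^ 2 := by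
        rw [ENNReal.tsum_add, ENNReal.tsum_mul_right, ENNReal.tsum_mul_left,
          ENNReal.tsum_mul_left, ENNReal.tsum_comm]
        simp only [ENNReal.tsum_mul_left]
    _ ≤ 2 * (A * 2 ^ (p - 1)) * (∑' x, W x ^ p) * N + 2 * (2 * N) := by
        gcongr
        refine le_trans (ENNReal.tsum_le_tsum fun n => ?_) hsum_high
        gcongr
        exact hhigh n
    _ = _ := by ring

end WeightedSobolev

/-! ### Lower bounds for `1 - â` on the period cell -/

section Symbol

variable {d : ℕ} {a : (Fin d → ℤ) → ℝ}

lemma hasSum_one_sub_jumpSymbol (ha : IsJumpDistribution a) (k : EuclideanSpace ℝ (Fin d)) :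
    HasSum (fun z => a z * (1 - Real.cos (∑ i, k i * (z i : ℝ)))) (1 - jumpSymbol a k) := by
  have h : Summable fun z => a z * Real.cos (∑ i, k i * (z i : ℝ)) := by
    refine .of_norm_bounded ha.hasSum_one.summable fun z => ?_
    rw [norm_mul, Real.norm_of_nonneg (ha.nonneg z)]
    exact mul_le_of_le_one_right (ha.nonneg z) (Real.abs_cos_le_one _)
  exact (ha.hasSum_one.sub h.hasSum).congr_fun fun z => by ring

/-- The quadratic lower bound on the symbol that comes from nearest neighbour jumps. -/
lemma exists_mul_norm_sq_le_one_sub_jumpSymbol (ha : IsJumpDistribution a) :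
    ∃ c : ℝ, 0 < c ∧ ∀ k : EuclideanSpace ℝ (Fin d), (∀ i, |k i| ≤ Real.pi) →
      c * ‖k‖ ^ 2 ≤ 1 - jumpSymbol a k := by
  have hpos : ∀ i : Fin d, 0 < a (Pi.single i 1) := fun i => ha.pos_of_unit _ (by
    rw [Finset.sum_eq_single i (fun j _ hj => by simp [hj]) (by simp)]
    simp)
  set S := ∑ i : Fin d, (a (Pi.single i 1) * (2 / Real.pi ^ 2))⁻¹ with hS
  have hpi : 0 < 2 / Real.pi ^ 2 := by positivity
  have hS0 : 0 ≤ S := Finset.sum_nonneg fun i _ => by have := hpos i; positivity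
  refine ⟨(S + 1)⁻¹, by positivity, fun k hk => ?_⟩
  have hsum := hasSum_one_sub_jumpSymbol ha k
  have hterm : ∀ z, 0 ≤ a z * (1 - Real.cos (∑ i, k i * (z i : ℝ))) := fun z =>
    mul_nonneg (ha.nonneg z) (sub_nonneg.2 (Real.cos_le_one _))
  have hM : 0 ≤ 1 - jumpSymbol a k := hsum.nonneg hterm
  rw [inv_mul_le_iff₀ (by positivity)]
  have hcoord : ∀ i, (k i) ^ 2 ≤ (a (Pi.single i 1) * (2 / Real.pi ^ 2))⁻¹ *
      (1 - jumpSymbol a k) := by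
    intro i
    have hai := hpos i
    rw [← div_eq_inv_mul, le_div_iff₀ (by positivity)]
    have h1 := le_hasSum hsum (Pi.single i 1) fun z _ => hterm z
    have h2 : ∑ j, k j * ((Pi.single i 1 : Fin d → ℤ) j : ℝ) = k i := by
      rw [Finset.sum_eq_single i (fun j _ hj => by simp [hj]) (by simp)]
      simp
    rw [h2] at h1
    -- `cos t ≤ 1 - (2/π²) t²` holds for `|t| ≤ π`, whence the restriction to the period cell.
    have h3 := Real.cos_le_one_sub_mul_cos_sq (hk i)
    have h4 : a (Pi.single i 1) * (2 / Real.pi ^ 2 * k i ^ 2) ≤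
        a (Pi.single i 1) * (1 - Real.cos (k i)) := by
      gcongr
      linarith
    linarith
  calc ‖k‖ ^ 2 = ∑ i, k i ^ 2 := by
        rw [EuclideanSpace.norm_sq_eq]
        simp
    _ ≤ ∑ i, (a (Pi.single i 1) * (2 / Real.pi ^ 2))⁻¹ * (1 - jumpSymbol a k) :=
        Finset.sum_le_sum fun i _ => hcoord i
    _ = S * (1 - jumpSymbol a k) := by rw [← Finset.sum_mul]
    _ ≤ (S + 1) * (1 - jumpSymbol a k) := by gcongr; linarith

lemma div_one_add_le_one_sub_exp_neg {x y : ℝ} (hx : 0 ≤ x) (hxy : x ≤ y) :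
    x / (1 + x) ≤ 1 - Real.exp (-y) := by
  have h1 : Real.exp (-y) ≤ (1 + x)⁻¹ := by
    rw [Real.exp_neg]
    exact inv_anti₀ (by linarith) (by linarith [Real.add_one_le_exp y])
  have h2 : x / (1 + x) = 1 - (1 + x)⁻¹ := by field_simp; ring
  linarith

/-- The lower bound on the symbol near the origin. -/
lemma HasSymbolAsymptotics.exists_mul_rpow_le {α : ℝ} (hα : 0 < α)
    (h : HasSymbolAsymptotics a α) :
    ∃ c : ℝ, 0 < c ∧ ∀ᶠ k in 𝓝[≠] (0 : EuclideanSpace ℝ (Fin d)),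
      c * ‖k‖ ^ α ≤ 1 - jumpSymbol a k := by
  obtain ⟨β, r, hβ, hβ0, hr, hsymb⟩ := h
  obtain ⟨b, hb0, hb⟩ := (isCompact_sphere (0 : EuclideanSpace ℝ (Fin d)) 1).exists_forall_le'
    hβ fun θ hθ => (hβ0 θ hθ).1
  -- Compactness of the sphere gives `β ≥ b > 0`; the half absorbs `1 + o(1)`, and the denominator
  -- comes from `1 - exp(-y) ≥ x/(1 + x)` with `x = (b/2)‖k‖^α ≤ b/2`.
  refine ⟨b / 2 / (1 + b / 2), by positivity, ?_⟩
  have hr2 : ∀ᶠ k in 𝓝[≠] (0 : EuclideanSpace ℝ (Fin d)), -(1 / 2) < r k :=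
    hr.eventually (lt_mem_nhds (by norm_num))
  have hball : ∀ᶠ k in 𝓝[≠] (0 : EuclideanSpace ℝ (Fin d)), k ∈ Metric.ball 0 1 :=
    mem_nhdsWithin_of_mem_nhds (Metric.ball_mem_nhds _ one_pos)
  filter_upwards [hsymb, hr2, hball, self_mem_nhdsWithin] with k hk hrk hk1 hk0
  have hn : 0 < ‖k‖ := norm_pos_iff.2 hk0
  have hk1 : ‖k‖ ≤ 1 := by simpa using (mem_ball_zero_iff.1 hk1).le
  have hβk : b ≤ β (‖k‖⁻¹ • k) := hb _ (by simp [norm_smul, hn.ne'])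
  have hp0 : 0 < ‖k‖ ^ α := Real.rpow_pos_of_pos hn _
  have hp1 : ‖k‖ ^ α ≤ 1 := Real.rpow_le_one hn.le hk1 hα.le
  rw [hk]
  have hle : b / 2 * ‖k‖ ^ α ≤ β (‖k‖⁻¹ • k) * ‖k‖ ^ α * (1 + r k) := by
    calc b / 2 * ‖k‖ ^ α = b * ‖k‖ ^ α * (1 / 2) := by ring
      _ ≤ β (‖k‖⁻¹ • k) * ‖k‖ ^ α * (1 + r k) := by
        have : 0 ≤ β (‖k‖⁻¹ • k) := hb0.le.trans hβk
        gcongr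
        linarith
  refine le_trans ?_ (div_one_add_le_one_sub_exp_neg (by positivity) hle)
  rw [div_mul_eq_mul_div]
  gcongr
  nlinarith

/-- The lower bound `1 - â(k) ≥ c |k|^α` on the whole period cell. -/
lemma HasSymbolAsymptotics.exists_mul_rpow_le_of_abs_le {α : ℝ} (hα : 0 < α) (hα2 : α ≤ 2)
    (ha : IsJumpDistribution a) (h : HasSymbolAsymptotics a α) :
    ∃ c : ℝ, 0 < c ∧ ∀ k : EuclideanSpace ℝ (Fin d), (∀ i, |k i| ≤ Real.pi) →
      c * ‖k‖ ^ α ≤ 1 - jumpSymbol a k := by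
  obtain ⟨c₁, hc₁, h₁⟩ := h.exists_mul_rpow_le hα
  obtain ⟨c₂, hc₂, h₂⟩ := exists_mul_norm_sq_le_one_sub_jumpSymbol ha
  rw [eventually_nhdsWithin_iff, Metric.eventually_nhds_iff] at h₁
  obtain ⟨δ, hδ, h₁⟩ := h₁
  have hδ' : 0 < δ ^ (α - 2) := Real.rpow_pos_of_pos hδ _
  -- For `‖k‖ ≥ δ` the quadratic bound suffices: `‖k‖ ^ (α - 2) ≤ δ ^ (α - 2)` because `α ≤ 2`.
  refine ⟨min c₁ (c₂ / δ ^ (α - 2)), by positivity, fun k hk => ?_⟩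
  have hM := h₂ k hk
  rcases eq_or_ne k 0 with rfl | hk0
  · simpa [Real.zero_rpow hα.ne'] using hM
  have hn : 0 < ‖k‖ := norm_pos_iff.2 hk0
  have hp : 0 < ‖k‖ ^ α := Real.rpow_pos_of_pos hn _
  rcases lt_or_ge ‖k‖ δ with hlt | hge
  · refine le_trans ?_ (h₁ (by simpa using hlt) hk0)
    gcongr
    exact min_le_left _ _
  · refine le_trans ?_ hM
    calc min c₁ (c₂ / δ ^ (α - 2)) * ‖k‖ ^ α ≤ c₂ / δ ^ (α - 2) * ‖k‖ ^ α := by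
          gcongr
          exact min_le_right _ _
      _ = c₂ / δ ^ (α - 2) * (‖k‖ ^ (α - 2) * ‖k‖ ^ 2) := by
          rw [← Real.rpow_natCast ‖k‖ 2, ← Real.rpow_add hn]
          norm_num
      _ ≤ c₂ / δ ^ (α - 2) * (δ ^ (α - 2) * ‖k‖ ^ 2) := by
          have := Real.rpow_le_rpow_of_nonpos hδ hge (by linarith : α - 2 ≤ 0)
          gcongr
      _ = c₂ * ‖k‖ ^ 2 := by field_simp

end Symbol

/-! ### Fourier transfer to the torus and the form bound -/

section Torus

open MeasureTheory UnitAddTorus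
open scoped ENNReal

variable {d : ℕ}

noncomputable local instance : MeasureSpace UnitAddCircle := ⟨AddCircle.haarAddCircle⟩

local instance : IsProbabilityMeasure (volume : Measure UnitAddCircle) :=
  inferInstanceAs (IsProbabilityMeasure AddCircle.haarAddCircle)

lemma exists_memLp_mFourierCoeff_eq (ψ : lp (fun _ : Fin d → ℤ => ℂ) 2) :
    ∃ f : UnitAddTorus (Fin d) → ℂ, MemLp f 2 ∧ ∀ x, mFourierCoeff f x = ψ x := by
  refine ⟨mFourierBasis.repr.symm ψ, Lp.memLp _, fun x => ?_⟩
  rw [← mFourierBasis_repr, LinearIsometryEquiv.apply_symm_apply]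

lemma tsum_enorm_mFourierCoeff_sq {f : UnitAddTorus (Fin d) → ℂ} (hf : MemLp f 2) :
    ∑' x, ‖mFourierCoeff f x‖ₑ ^ 2 = ∫⁻ t, ‖f t‖ₑ ^ 2 := by
  have h := hasSum_sq_mFourierCoeff (hf.toLp f)
  have h1 : ∀ x, mFourierCoeff (hf.toLp f) x = mFourierCoeff f x := fun x =>
    integral_congr_ae (hf.coeFn_toLp.mono fun t ht => by simp only [ht])
  have h2 : ∫ t, ‖hf.toLp f t‖ ^ 2 = ∫ t, ‖f t‖ ^ 2 :=
    integral_congr_ae (hf.coeFn_toLp.mono fun t ht => by simp only [ht])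
  simp only [h1, h2] at h
  have h3 : Integrable fun t => ‖f t‖ ^ 2 := hf.integrable_norm_pow (by norm_num)
  calc ∑' x, ‖mFourierCoeff f x‖ₑ ^ 2 = ∑' x, ENNReal.ofReal (‖mFourierCoeff f x‖ ^ 2) := by
        simp [ENNReal.ofReal_pow]
    _ = ENNReal.ofReal (∫ t, ‖f t‖ ^ 2) := by
        rw [← ENNReal.ofReal_tsum_of_nonneg (fun x => by positivity) h.summable, h.tsum_eq]
    _ = ∫⁻ t, ‖f t‖ₑ ^ 2 := by
        rw [ofReal_integral_eq_lintegral_ofReal h3 (Eventually.of_forall fun t => by positivity)]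
        simp [ENNReal.ofReal_pow]

lemma volume_closedBall_unitAddTorus_le {r : ℝ} (hr : 0 ≤ r) :
    volume (Metric.closedBall (0 : UnitAddTorus (Fin d)) r) ≤ ENNReal.ofReal (2 * r) ^ d := by
  rw [closedBall_pi _ hr, volume_pi, Measure.pi_pi]
  have h : ∀ x : UnitAddCircle, volume (Metric.closedBall x r) ≤ ENNReal.ofReal (2 * r) := by
    intro x
    have h1 := AddCircle.volume_closedBall 1 (x := x) r
    rw [AddCircle.volume_eq_smul_haarAddCircle, ENNReal.ofReal_one, one_smul] at h1
    exact h1.trans_le (ENNReal.ofReal_le_ofReal (min_le_right _ _))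
  exact (Finset.prod_le_prod' fun i _ => h _).trans_eq (by simp)

lemma enorm_mFourier (z : Fin d → ℤ) (t : UnitAddTorus (Fin d)) : ‖mFourier z t‖ₑ = 1 := by
  have : ‖mFourier z t‖ = 1 := by
    simp only [mFourier, ContinuousMap.coe_mk, norm_prod, fourier_apply, Circle.norm_coe,
      Finset.prod_const_one]
  rw [← ofReal_norm, this, ENNReal.ofReal_one]

lemma UnitAddCircle.exists_coe_eq_and_abs_eq_norm (θ : UnitAddCircle) :
    ∃ x : ℝ, (x : UnitAddCircle) = θ ∧ |x| = ‖θ‖ ∧ |x| ≤ 1 / 2 := by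
  obtain ⟨y, rfl⟩ := QuotientAddGroup.mk_surjective θ
  refine ⟨y - round y, ?_, (UnitAddCircle.norm_eq (x := y)).symm, abs_sub_round y⟩
  rw [AddCircle.coe_sub]
  have : ((round y : ℝ) : UnitAddCircle) = 0 := by
    rw [AddCircle.coe_eq_zero_iff]
    exact ⟨round y, by simp⟩
  rw [this, sub_zero]

lemma norm_mFourier_sub_one_sq (z : Fin d → ℤ) (x : Fin d → ℝ) :
    ‖mFourier z (fun i => (x i : UnitAddCircle)) - 1‖ ^ 2 =
      2 * (1 - Real.cos (∑ i, 2 * Real.pi * x i * z i)) := by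
  have h : mFourier z (fun i => (x i : UnitAddCircle)) =
      Complex.exp ((∑ i, 2 * Real.pi * x i * z i : ℝ) * Complex.I) := by
    simp only [mFourier, ContinuousMap.coe_mk, fourier_coe_apply, ← Complex.exp_sum]
    congr 1
    push_cast
    rw [Finset.sum_mul]
    exact Finset.sum_congr rfl fun i _ => by ring
  rw [h, ← Complex.normSq_eq_norm_sq, Complex.normSq_apply]
  simp only [Complex.sub_re, Complex.sub_im, Complex.exp_ofReal_mul_I_re,
    Complex.exp_ofReal_mul_I_im, Complex.one_re, Complex.one_im]
  nlinarith [Real.sin_sq_add_cos_sq (∑ i, 2 * Real.pi * x i * z i)]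

/-- The weight `2 (1 - â)` on the torus. -/
noncomputable def torusWeight (a : (Fin d → ℤ) → ℝ) (t : UnitAddTorus (Fin d)) : ℝ≥0∞ :=
  ∑' z, ENNReal.ofReal (a z) * ‖mFourier z t - 1‖ₑ ^ 2

lemma measurable_torusWeight (a : (Fin d → ℤ) → ℝ) : Measurable (torusWeight a) :=
  Measurable.tsum fun z => (((mFourier z).continuous.measurable.sub_const 1).enorm.pow_const
    2).const_mul _

/-- Lift `t` to `x` with `|x i| ≤ 1/2` and put `k = 2πx`, which lies in the period cell. The torus
carries the sup norm, so `‖t‖ ≤ ‖k‖`; the weight is `2(1 - â(k))`, and its factor 2 is discarded. -/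
lemma ofReal_mul_rpow_le_torusWeight {a : (Fin d → ℤ) → ℝ} (ha : IsJumpDistribution a) {c γ : ℝ}
    (hc : 0 < c) (hγ : 0 < γ) (h : ∀ k : EuclideanSpace ℝ (Fin d), (∀ i, |k i| ≤ Real.pi) →
      c * ‖k‖ ^ γ ≤ 1 - jumpSymbol a k) (t : UnitAddTorus (Fin d)) :
    ENNReal.ofReal (c * ‖t‖ ^ γ) ≤ torusWeight a t := by
  choose x hx hxn hx2 using fun i => UnitAddCircle.exists_coe_eq_and_abs_eq_norm (t i)
  obtain rfl : (fun i => (x i : UnitAddCircle)) = t := funext hx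
  set k : EuclideanSpace ℝ (Fin d) := WithLp.toLp 2 fun i => 2 * Real.pi * x i with hk
  have hki : ∀ i, |k i| = 2 * Real.pi * |x i| := fun i => by
    change |2 * Real.pi * x i| = _
    rw [abs_mul, abs_of_pos (by positivity)]
  have hsum := hasSum_one_sub_jumpSymbol ha k
  have hterm : ∀ z, 0 ≤ a z * (1 - Real.cos (∑ i, k i * (z i : ℝ))) := fun z =>
    mul_nonneg (ha.nonneg z) (sub_nonneg.2 (Real.cos_le_one _))
  have hle : ‖(fun i => (x i : UnitAddCircle) : UnitAddTorus (Fin d))‖ ≤ ‖k‖ := by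
    refine (pi_norm_le_iff_of_nonneg (norm_nonneg _)).2 fun i => ?_
    refine le_trans ?_ (PiLp.norm_apply_le k i)
    rw [Real.norm_eq_abs, hki, ← hxn]
    nlinarith [Real.pi_gt_three, abs_nonneg (x i)]
  have h1 : c * ‖(fun i => (x i : UnitAddCircle) : UnitAddTorus (Fin d))‖ ^ γ ≤
      1 - jumpSymbol a k := by
    refine le_trans ?_ (h k fun i => ?_)
    · gcongr
    · rw [hki]
      nlinarith [Real.pi_pos, hx2 i]
  refine (ENNReal.ofReal_le_ofReal h1).trans ?_
  rw [← hsum.tsum_eq, ENNReal.ofReal_tsum_of_nonneg hterm hsum.summable]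
  refine ENNReal.tsum_le_tsum fun z => ?_
  rw [ENNReal.ofReal_mul (ha.nonneg z)]
  gcongr
  rw [← ofReal_norm, ← ENNReal.ofReal_pow (norm_nonneg _), norm_mFourier_sub_one_sq]
  refine ENNReal.ofReal_le_ofReal ?_
  change 1 - Real.cos (∑ i, 2 * Real.pi * x i * (z i : ℝ)) ≤ _
  linarith [Real.cos_le_one (∑ i, 2 * Real.pi * x i * (z i : ℝ))]

/-- The sublevel set lies in a ball of radius `(r/c)^(1/γ)`, of volume at most `2^d (r/c)^(d/γ)`. -/
lemma exists_volume_torusWeight_le {a : (Fin d → ℤ) → ℝ} (ha : IsJumpDistribution a) {c γ : ℝ}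
    (hc : 0 < c) (hγ : 0 < γ) (hd : 0 < d)
    (h : ∀ k : EuclideanSpace ℝ (Fin d), (∀ i, |k i| ≤ Real.pi) →
      c * ‖k‖ ^ γ ≤ 1 - jumpSymbol a k) :
    ∃ C : ℝ≥0∞, C ≠ ∞ ∧ ∀ r : ℝ≥0∞,
      volume {t : UnitAddTorus (Fin d) | torusWeight a t ≤ r} ≤ C * r ^ ((d : ℝ) / γ) := by
  have hC0 : 0 < (2 : ℝ) ^ d * c⁻¹ ^ ((d : ℝ) / γ) := by positivity
  refine ⟨ENNReal.ofReal (2 ^ d * c⁻¹ ^ ((d : ℝ) / γ)), ENNReal.ofReal_ne_top, fun r => ?_⟩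
  rcases eq_or_ne r ∞ with rfl | hr
  · rw [ENNReal.top_rpow_of_pos (by positivity), ENNReal.mul_top (ENNReal.ofReal_pos.2 hC0).ne']
    exact le_top
  lift r to NNReal using hr
  set ρ : ℝ := (c⁻¹ * r) ^ γ⁻¹ with hρ
  have hρ0 : 0 ≤ ρ := by positivity
  have hsub : {t : UnitAddTorus (Fin d) | torusWeight a t ≤ r} ⊆ Metric.closedBall 0 ρ := by
    intro t ht
    have h1 := (ofReal_mul_rpow_le_torusWeight ha hc hγ h t).trans ht
    rw [← ENNReal.ofReal_coe_nnreal, ENNReal.ofReal_le_ofReal_iff r.coe_nonneg] at h1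
    rw [mem_closedBall_zero_iff, hρ, Real.le_rpow_inv_iff_of_pos (norm_nonneg _) (by positivity) hγ,
      le_inv_mul_iff₀ hc]
    exact h1
  refine (measure_mono hsub).trans ((volume_closedBall_unitAddTorus_le hρ0).trans_eq ?_)
  rw [← ENNReal.ofReal_coe_nnreal, ENNReal.ofReal_rpow_of_nonneg r.coe_nonneg (by positivity),
    ← ENNReal.ofReal_mul hC0.le, ← ENNReal.ofReal_pow (by positivity)]
  congr 1
  rw [mul_pow, mul_assoc, ← Real.mul_rpow (by positivity) r.coe_nonneg, hρ, ← Real.rpow_natCast (_ ^ γ⁻¹),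
    ← Real.rpow_mul (by positivity)]
  congr 2
  field_simp

lemma integrable_mFourier_mul {f : UnitAddTorus (Fin d) → ℂ} (hf : MemLp f 2) (z : Fin d → ℤ) :
    Integrable fun t => mFourier z t * f t :=
  (hf.integrable one_le_two).bdd_mul (c := 1) (mFourier z).continuous.aestronglyMeasurable
    (Eventually.of_forall fun t => by
      have := (enorm_mFourier z t).le
      rwa [← ofReal_norm, ENNReal.ofReal_le_one] at this)

lemma mFourierCoeff_mFourier_sub_one_mul {f : UnitAddTorus (Fin d) → ℂ} (hf : MemLp f 2)
    (z x : Fin d → ℤ) : mFourierCoeff (fun t => (mFourier z t - 1) * f t) x =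
      mFourierCoeff f (x - z) - mFourierCoeff f x := by
  simp only [mFourierCoeff, smul_eq_mul]
  rw [← integral_sub (integrable_mFourier_mul hf _) (integrable_mFourier_mul hf _)]
  congr 1
  ext t
  rw [neg_sub, sub_eq_neg_add z x, mFourier_add]
  ring

/-- Translation by `z` is an isometry. Needed because multiplying `f` by the monomial `z` translates
its coefficients by `-z`. -/
lemma norm_shiftOp_neg_sub {G : Type*} [AddCommGroup G] (z : G) (ψ : lp (fun _ : G => ℂ) 2) :
    ‖shiftOp (-z) ψ - ψ‖ = ‖shiftOp z ψ - ψ‖ := by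
  rw [← norm_shiftOp_apply z, norm_sub_rev (shiftOp z ψ)]
  congr 1
  rw [map_sub]
  congr 1
  ext x
  simp

lemma enorm_sq_eq_tsum {ι : Type*} (ψ : lp (fun _ : ι => ℂ) 2) :
    ENNReal.ofReal (‖ψ‖ ^ 2) = ∑' x, ‖ψ x‖ₑ ^ 2 := by
  rw [norm_sq_eq_tsum_norm_sq, ENNReal.ofReal_tsum_of_nonneg (fun x => by positivity)
    (summable_norm_sq ψ)]
  simp [ENNReal.ofReal_pow]

/-- `∫ 2(1 - â) |f|² = ∑_z a(z) ‖ψ(· + z) - ψ‖²`, where `ψ` are the Fourier coefficients of `f`. -/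
lemma lintegral_torusWeight_mul {a : (Fin d → ℤ) → ℝ} (ha0 : ∀ z, 0 ≤ a z)
    {ψ : lp (fun _ : Fin d → ℤ => ℂ) 2} {f : UnitAddTorus (Fin d) → ℂ} (hf : MemLp f 2)
    (hψ : ∀ x, mFourierCoeff f x = ψ x) :
    ∫⁻ t, torusWeight a t * ‖f t‖ₑ ^ 2 =
      ∑' z, ENNReal.ofReal (a z * ‖shiftOp z ψ - ψ‖ ^ 2) := by
  have hmem : ∀ z : Fin d → ℤ, MemLp (fun t => (mFourier z t - 1) * f t) 2 := fun z =>
    hf.of_le_mul (c := 2) (((mFourier z).continuous.sub continuous_const).aestronglyMeasurable.mul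
      hf.1) (Eventually.of_forall fun t => by
        have h1 : ‖mFourier z t‖ ≤ 1 := by
          have := (enorm_mFourier z t).le
          rwa [← ofReal_norm, ENNReal.ofReal_le_one] at this
        rw [norm_mul]
        gcongr
        refine (norm_sub_le _ _).trans ?_
        rw [norm_one]
        linarith)
  have hterm : ∀ z : Fin d → ℤ, ∫⁻ t, ‖(mFourier z t - 1) * f t‖ₑ ^ 2 =
      ENNReal.ofReal (‖shiftOp z ψ - ψ‖ ^ 2) := by
    intro z
    rw [← tsum_enorm_mFourierCoeff_sq (hmem z), ← norm_shiftOp_neg_sub, enorm_sq_eq_tsum]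
    refine tsum_congr fun x => ?_
    rw [mFourierCoeff_mFourier_sub_one_mul hf, hψ, hψ, lp.coeFn_sub, Pi.sub_apply, shiftOp_apply,
      sub_eq_add_neg x z]
  have hpt : ∀ t, torusWeight a t * ‖f t‖ₑ ^ 2 =
      ∑' z, ENNReal.ofReal (a z) * ‖(mFourier z t - 1) * f t‖ₑ ^ 2 := fun t => by
    simp only [torusWeight, ← ENNReal.tsum_mul_right, enorm_mul, mul_pow, mul_assoc]
  simp only [hpt]
  rw [lintegral_tsum fun z => ((hmem z).1.enorm.pow_const 2).const_mul _]
  refine tsum_congr fun z => ?_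
  rw [lintegral_const_mul' _ _ ENNReal.ofReal_ne_top, hterm, ENNReal.ofReal_mul (ha0 z)]

/-- The form inequality `∑ |V| |ψ|² ≤ K ⟨(1 - A)ψ, ψ⟩` for `V ∈ ℓ^{d/γ}`, given a lower bound of
order `γ < d` on the symbol. -/
theorem exists_tsum_abs_mul_norm_sq_le {a : (Fin d → ℤ) → ℝ} (ha : IsJumpDistribution a)
    {c γ : ℝ} (hc : 0 < c) (hγ : 0 < γ) (hγd : γ < d)
    (h : ∀ k : EuclideanSpace ℝ (Fin d), (∀ i, |k i| ≤ Real.pi) →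
      c * ‖k‖ ^ γ ≤ 1 - jumpSymbol a k)
    {V : (Fin d → ℤ) → ℝ} {B : ℝ} (hB : ∀ x, |V x| ≤ B)
    (hV : Summable fun x => |V x| ^ ((d : ℝ) / γ)) :
    ∃ K : ℝ, 0 ≤ K ∧ ∀ ψ : lp (fun _ : Fin d → ℤ => ℂ) 2,
      ∑' x, |V x| * ‖ψ x‖ ^ 2 ≤ K * (inner ℂ (jumpOp a ψ) ψ).re := by
  have hd : 0 < d := by
    have := hγ.trans hγd
    exact_mod_cast this
  obtain ⟨C, hC, hμ⟩ := exists_volume_torusWeight_le ha hc hγ hd h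
  have hB0 : 0 ≤ B := (abs_nonneg _).trans (hB 0)
  have hB1 : 0 < B + 1 := by linarith
  have hp : 1 < (d : ℝ) / γ := (one_lt_div hγ).2 hγd
  -- Normalised so that `W ≤ 1`; dividing by `B + 1` stays safe when `B = 0`.
  set W : (Fin d → ℤ) → ℝ≥0∞ := fun x => ENNReal.ofReal (|V x| / (B + 1)) with hW
  have hWp : ∑' x, W x ^ ((d : ℝ) / γ) ≠ ∞ := by
    have heq : ∀ x, W x ^ ((d : ℝ) / γ) =
        ENNReal.ofReal (|V x| ^ ((d : ℝ) / γ) / (B + 1) ^ ((d : ℝ) / γ)) := fun x => by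
      rw [hW, ENNReal.ofReal_rpow_of_nonneg (by positivity) (by positivity),
        Real.div_rpow (abs_nonneg _) hB1.le]
    simp only [heq]
    rw [← ENNReal.ofReal_tsum_of_nonneg (fun x => by positivity) (hV.div_const _)]
    exact ENNReal.ofReal_ne_top
  obtain ⟨K, hK, hle⟩ := exists_tsum_mul_enorm_integral_sq_le
    (μ := (volume : Measure (UnitAddTorus (Fin d)))) (fun x t => mFourier (-x) t)
    (fun x t => (enorm_mFourier _ _).le) (fun x => (mFourier (-x)).continuous.measurable)
    (fun f hf => (tsum_enorm_mFourierCoeff_sq hf).le) (measurable_torusWeight a) hC hp hμ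
    (W := W) (fun x => ENNReal.ofReal_le_one.2 (div_le_one_of_le₀ (by linarith [hB x]) hB1.le)) hWp
  lift K to NNReal using hK
  -- `B + 1` undoes the normalisation of `V`; the 2 is the one in `∫ s|f|² = 2⟨Dψ, ψ⟩`.
  refine ⟨(B + 1) * (K * 2), by positivity, fun ψ => ?_⟩
  obtain ⟨f, hf, hψ⟩ := exists_memLp_mFourierCoeff_eq ψ
  have hQ := hasSum_norm_sq_shiftOp_sub ha.hasSum_one ha.nonneg ψ
  have hQ0 := re_inner_jumpOp_nonneg ha.hasSum_one ha.nonneg ψ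
  have h1 := hle f hf
  rw [lintegral_torusWeight_mul ha.nonneg hf hψ, ← ENNReal.ofReal_tsum_of_nonneg
    (fun z => mul_nonneg (ha.nonneg z) (by positivity)) hQ.summable, hQ.tsum_eq] at h1
  have hsum : Summable fun x => |V x| / (B + 1) * ‖ψ x‖ ^ 2 :=
    .of_nonneg_of_le (fun x => by positivity)
      (fun x => mul_le_of_le_one_left (by positivity)
        (div_le_one_of_le₀ (by linarith [hB x]) hB1.le)) (summable_norm_sq ψ)
  have h2 : ∑' x, W x * ‖∫ t, mFourier (-x) t * f t‖ₑ ^ 2 =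
      ENNReal.ofReal (∑' x, |V x| / (B + 1) * ‖ψ x‖ ^ 2) := by
    rw [ENNReal.ofReal_tsum_of_nonneg (fun x => by positivity) hsum]
    refine tsum_congr fun x => ?_
    have h3 : ∫ t, mFourier (-x) t * f t = ψ x := hψ x
    rw [h3, ENNReal.ofReal_mul (by positivity), ENNReal.ofReal_pow (norm_nonneg _), ofReal_norm]
  rw [h2, ← ENNReal.ofReal_coe_nnreal, ← ENNReal.ofReal_mul K.coe_nonneg,
    ENNReal.ofReal_le_ofReal_iff (by positivity)] at h1
  have h4 : ∑' x, |V x| * ‖ψ x‖ ^ 2 = (B + 1) * ∑' x, |V x| / (B + 1) * ‖ψ x‖ ^ 2 := by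
    rw [← tsum_mul_left]
    refine tsum_congr fun x => ?_
    field_simp
  rw [h4, mul_assoc]
  gcongr
  linarith

end Torus

/-! ### The form bound for `V` and the critical coupling -/

lemma tendsto_cofinite_zero_of_summable_abs_rpow {ι : Type*} {V : ι → ℝ} {p : ℝ} (hp : 0 < p)
    (h : Summable fun x => |V x| ^ p) : Tendsto V cofinite (𝓝 0) := by
  rw [tendsto_zero_iff_abs_tendsto_zero]
  have h1 := h.tendsto_cofinite_zero.rpow_const (p := p⁻¹) (Or.inr (by positivity))
  rw [Real.zero_rpow (by positivity)] at h1
  refine h1.congr fun x => ?_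
  rw [← Real.rpow_mul (abs_nonneg _), mul_inv_cancel₀ hp.ne', Real.rpow_one]
  rfl

lemma exists_abs_le_of_tendsto_cofinite_zero {ι : Type*} {V : ι → ℝ}
    (h : Tendsto V cofinite (𝓝 0)) : ∃ B, ∀ x, |V x| ≤ B := by
  obtain ⟨B, hB⟩ := h.abs.bddAbove_range_of_cofinite
  exact ⟨B, fun x => hB ⟨x, rfl⟩⟩

/-- Under the Cwikel–Lieb–Rozenblum condition the potential vanishes at infinity and is form bounded
with respect to the generator of the random walk. -/
lemma CLRCondition.exists_form_bound {d : ℕ} {α : ℝ} (hα0 : 0 < α) (hα2 : α ≤ 2)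
    {a : (Fin d → ℤ) → ℝ} (ha : IsJumpDistribution a) (hsymbol : HasSymbolAsymptotics a α)
    {V : (Fin d → ℤ) → ℝ} (hV : CLRCondition α V) :
    Tendsto V cofinite (𝓝 0) ∧ ∃ K : ℝ, 0 ≤ K ∧ ∀ ψ : lp (fun _ : Fin d → ℤ => ℂ) 2,
      ∑' x, |V x| * ‖ψ x‖ ^ 2 ≤ K * (inner ℂ (jumpOp a ψ) ψ).re := by
  -- Both alternatives need only a symbol bound of some order `γ < d`: `γ = α` in dimensions one and
  -- two, `γ = 2` from nearest neighbour jumps when `d ≥ 3`.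
  have key : ∀ (c γ : ℝ), 0 < c → 0 < γ → γ < d →
      (∀ k : EuclideanSpace ℝ (Fin d), (∀ i, |k i| ≤ Real.pi) →
        c * ‖k‖ ^ γ ≤ 1 - jumpSymbol a k) → (Summable fun x => |V x| ^ ((d : ℝ) / γ)) →
      Tendsto V cofinite (𝓝 0) ∧ ∃ K : ℝ, 0 ≤ K ∧ ∀ ψ : lp (fun _ : Fin d → ℤ => ℂ) 2,
        ∑' x, |V x| * ‖ψ x‖ ^ 2 ≤ K * (inner ℂ (jumpOp a ψ) ψ).re := by
    intro c γ hc hγ hγd hlow hsum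
    have h0 := tendsto_cofinite_zero_of_summable_abs_rpow (div_pos (hγ.trans hγd) hγ) hsum
    obtain ⟨B, hB⟩ := exists_abs_le_of_tendsto_cofinite_zero h0
    exact ⟨h0, exists_tsum_abs_mul_norm_sq_le ha hc hγ hγd hlow hB hsum⟩
  rcases hV with ⟨hd, hsum⟩ | ⟨hd, hsum⟩
  · obtain ⟨c, hc, hlow⟩ := hsymbol.exists_mul_rpow_le_of_abs_le hα0 hα2 ha
    refine key c α hc hα0 ?_ hlow hsum
    rcases hd with ⟨rfl, h⟩ | ⟨rfl, h⟩ <;> simpa using h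
  · obtain ⟨c, hc, hlow⟩ := exists_mul_norm_sq_le_one_sub_jumpSymbol ha
    refine key c 2 hc two_pos ?_ (fun k hk => ?_) hsum
    · have : (3 : ℝ) ≤ d := by exact_mod_cast hd
      linarith
    · rw [Real.rpow_two]
      exact hlow k hk

lemma re_inner_jumpOp_le {G : Type*} [AddCommGroup G] {a : G → ℝ} (ha : HasSum a 1)
    (ha0 : ∀ z, 0 ≤ a z) (ψ : lp (fun _ : G => ℂ) 2) :
    (inner ℂ (jumpOp a ψ) ψ).re ≤ 2 * ‖ψ‖ ^ 2 := by
  have h := hasSum_le (fun z => ?_) (hasSum_norm_sq_shiftOp_sub ha ha0 ψ)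
    (ha.mul_right (4 * ‖ψ‖ ^ 2))
  · linarith
  · have h1 := norm_sub_le (shiftOp z ψ) ψ
    rw [norm_shiftOp_apply] at h1
    have h2 : ‖shiftOp z ψ - ψ‖ ^ 2 ≤ (‖ψ‖ + ‖ψ‖) ^ 2 := by gcongr
    exact mul_le_mul_of_nonneg_left (by linarith) (ha0 z)

theorem mainTheorem4 (d : ℕ) (α : ℝ) (hα0 : 0 < α) (hα2 : α ≤ 2)
    (a : (Fin d → ℤ) → ℝ) (ha : IsJumpDistribution a) (hsymbol : HasSymbolAsymptotics a α)
    (V : (Fin d → ℤ) → ℝ) (hV : CLRCondition α V) (hpos : ∃ x, 0 < V x) :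
    ∃ σcr : ℝ, 0 < σcr ∧
      (∀ σ : ℝ, 0 < σ → σ < σcr → ¬ ∃ lam : ℝ, 0 < lam ∧ IsSchrodingerEigenvalue a V σ lam) ∧
      (∀ σ : ℝ, σcr < σ → ∃ lam : ℝ, 0 < lam ∧ IsSchrodingerEigenvalue a V σ lam) := by
  classical
  obtain ⟨h0, K, hK0, hK⟩ := hV.exists_form_bound hα0 hα2 ha hsymbol
  obtain ⟨B, hB⟩ := exists_abs_le_of_tendsto_cofinite_zero h0
  set Q : lp (fun _ : Fin d → ℤ => ℂ) 2 → ℝ := fun ψ => (inner ℂ (jumpOp a ψ) ψ).re with hQ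
  set P : lp (fun _ : Fin d → ℤ => ℂ) 2 → ℝ := fun ψ => (inner ℂ (mulOp V hB ψ) ψ).re with hP
  have hQ0 : ∀ ψ, 0 ≤ Q ψ := re_inner_jumpOp_nonneg ha.hasSum_one ha.nonneg
  have hPQ : ∀ ψ, P ψ ≤ K * Q ψ := fun ψ => by
    have h1 := hasSum_re_inner_mulOp V hB ψ
    refine le_trans ?_ (hK ψ)
    refine hasSum_le (fun x => ?_) h1 (Summable.hasSum ?_)
    · gcongr
      exact le_abs_self _
    · exact .of_nonneg_of_le (fun x => by positivity)
        (fun x => mul_le_mul_of_nonneg_right (hB x) (by positivity))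
        ((summable_norm_sq ψ).mul_left B)
  have hform : ∀ (σ : ℝ) (ψ : lp (fun _ : Fin d → ℤ => ℂ) 2),
      (inner ℂ (((σ : ℂ) • mulOp V hB) ψ - jumpOp a ψ) ψ).re = σ * P ψ - Q ψ := fun σ ψ => by
    have : ((σ : ℂ) • mulOp V hB) ψ = (σ : ℂ) • mulOp V hB ψ := rfl
    rw [this, inner_sub_left, inner_smul_left, Complex.sub_re, Complex.conj_ofReal,
      Complex.re_ofReal_mul]
  -- positive eigenvalues exist exactly when the form is positive somewhere
  have hiff : ∀ σ : ℝ, (∃ lam : ℝ, 0 < lam ∧ IsSchrodingerEigenvalue a V σ lam) ↔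
      ∃ ψ, Q ψ < σ * P ψ := by
    intro σ
    simp only [isSchrodingerEigenvalue_iff ha V hB]
    constructor
    · rintro ⟨lam, hlam, ψ, hψ, h⟩
      refine ⟨ψ, ?_⟩
      have h1 := hform σ ψ
      rw [h, inner_smul_left, Complex.conj_ofReal, Complex.re_ofReal_mul] at h1
      have h2 : (inner ℂ ψ ψ).re = ‖ψ‖ ^ 2 := by
        rw [← inner_self_eq_norm_sq (𝕜 := ℂ)]; rfl
      have h3 : 0 < ‖ψ‖ := norm_pos_iff.2 hψ
      have h4 : 0 < lam * ‖ψ‖ ^ 2 := by positivity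
      rw [h2] at h1
      linarith
    · rintro ⟨ψ, h⟩
      refine exists_pos_eigenvalue_of_compact_sub_nonneg (jumpOp a) ((σ : ℂ) • mulOp V hB)
        (inner_jumpOp ha.hasSum_one.summable ha.nonneg ha.symm) (fun φ ψ => ?_) hQ0
        ((isCompactOperator_mulOp V hB h0).smul (σ : ℂ)) ⟨ψ, ?_⟩
      · have h1 : ∀ χ, ((σ : ℂ) • mulOp V hB) χ = (σ : ℂ) • mulOp V hB χ := fun χ => rfl
        rw [h1, h1, inner_smul_left, inner_smul_right, Complex.conj_ofReal, inner_mulOp]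
      · rw [hform]
        linarith
  set S : Set ℝ := {σ | 0 < σ ∧ ∃ ψ, Q ψ < σ * P ψ} with hS
  -- `Q ψ < σ P ψ ≤ σ K Q ψ` forces `Q ψ > 0` and `σ K > 1`; `K + 1` avoids inverting a possible
  -- zero.
  have hlow : ∀ σ ∈ S, (K + 1)⁻¹ ≤ σ := by
    rintro σ ⟨hσ, ψ, h⟩
    have h1 := mul_le_mul_of_nonneg_left (hPQ ψ) hσ.le
    have h2 : 0 < Q ψ := by
      refine (hQ0 ψ).lt_of_ne fun he => ?_
      rw [← he, mul_zero, mul_zero] at h1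
      linarith
    rw [inv_le_iff_one_le_mul₀ (by positivity)]
    by_contra hlt
    push Not at hlt
    nlinarith
  have hne : S.Nonempty := by
    obtain ⟨x₀, hx₀⟩ := hpos
    let ψ : lp (fun _ : Fin d → ℤ => ℂ) 2 := lp.single 2 x₀ 1
    have hn : ‖ψ‖ = 1 := by
      simp [ψ]
    have hPψ : P ψ = V x₀ := by
      refine (hasSum_re_inner_mulOp V hB ψ).unique ?_
      refine (hasSum_ite_eq x₀ (V x₀)).congr_fun fun x => ?_
      by_cases hx : x = x₀ <;> simp [ψ, hx, lp.single_apply]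
    have hQψ : Q ψ ≤ 2 := by
      have := re_inner_jumpOp_le ha.hasSum_one ha.nonneg ψ
      rw [hn] at this
      linarith
    -- On the delta function `Q ≤ 2` and `P = V x₀`, so this coupling gives `σP = 3 > Q`.
    refine ⟨3 / V x₀, by positivity, ψ, ?_⟩
    rw [hPψ, div_mul_cancel₀ _ hx₀.ne']
    linarith
  have hbdd : BddBelow S := ⟨_, hlow⟩
  refine ⟨sInf S, lt_of_lt_of_le (by positivity) (le_csInf hne hlow), fun σ hσ hlt => ?_,
    fun σ hlt => ?_⟩
  · rw [hiff]
    exact fun h => notMem_of_lt_csInf hlt hbdd ⟨hσ, h⟩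
  · rw [hiff]
    obtain ⟨τ, ⟨hτ, ψ, h⟩, hτσ⟩ := exists_lt_of_csInf_lt hne hlt
    refine ⟨ψ, h.trans_le ?_⟩
    -- `τ P ψ > Q ψ ≥ 0`, so the witness for `τ` also serves every larger `σ`.
    have : 0 < P ψ := by
      by_contra hneg
      push Not at hneg
      nlinarith [hQ0 ψ]
    gcongr
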